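/- **Setting.** Let $\Omega$ be a Polish space with its Borel $\sigma$-algebra, $k(x,dy)$ a kernel on $\Omega$ with $k(x,\Omega)<\infty$ for all $x$, and $\mu$ a $\sigma$-finite measure such that $k(x,\Omega)>0$ for $\mu$-a.e. $x$ and such that the measure $K(dx,dy)=\mu(dx)\,k(x,dy)$ on $\Omega\times\Omega$ is symmetric (reversibility) and satisfies $K(\Omega\times\Omega)<\infty$. Let $X=(X_t)_{t\ge0}$ be the minimal Markov jump process with jump rates $k$, with law $\mathbb P_x$ when started in $x$, and let $\tau_C=\inf\{t>0: X_t\in C\}$ (with $\inf\emptyset=\infty$). Assume that $X$ is irreducible: for every measurable $C$ with $\mu(C)>0$, $\mathbb P_x(\tau_C<\infty)>0$ for $\mu$-a.e. $x$. (Since $K$ is finite, $X$ is then automatically recurrent: from $\mu$-a.e. starting point it a.s. visits every given set of positive measure at arbitrarily large times.) Let $A,B\subset\Omega$ be disjoint and measurable, and define $$h_{AB}(x)=\begin{cases}1,&x\in A,\\0,&x\in B,\\ \mathbb P_x(\tau_A<\tau_B),&x\notin A\cup B,\end{cases}\qquad (Lf)(x)=\int_\Omega [f(y)-f(x)]\,k(x,dy),\qquad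 \mathrm{Cap}(A,B)=\int_A(-Lh_{AB})\,d\mu .$$ Let $\Gamma_{AB}$ be the set of finite paths $\gamma=(\gamma_0,\dots,\gamma_n)$ with $\gamma_0\in A$, $\gamma_n\in B$ and $\gamma_i\notin B$ for $0<i<n$. The edge measure $\Phi_{\mathbb P}$ of a probability measure $\mathbb P$ on $\Gamma_{AB}$ is determined by $\int f\,d\Phi_{\mathbb P}=\mathbb E\bigl[\sum_{j=1}^n f(\gamma_{j-1},\gamma_j)\bigr]$ for all measurable $f\ge0$. Let $\mathcal P^K_{AB}$ be the set of probability measures $\mathbb P$ on $\Gamma_{AB}$ with $\Phi_{\mathbb P}\ll K$. **Theorem (Berman–Konsowa principle, path version).** One has $\mathrm{Cap}(A,B)\ge 0$ and $$\mathrm{Cap}(A,B)=\sup_{\mathbb P\in\mathcal P^K_{AB}}\mathbb E\Bigl[\Bigl(\sum_{j=1}^{n}\frac{d\Phi_{\mathbb P}}{dK}(\gamma_{j-1},\gamma_j)\Bigr)^{-1}\Bigr]$$ (the expectation and the supremum are taken in $[0,\infty]$, with $\sup\emptyset=0$), and the identity remains true when the supremum is restricted to those $\mathbb P\in\mathcal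 P^K_{AB}$ that are concentrated on self-avoiding paths. Moreover, if $\mu(A)>0$ and $\mu(B)>0$, then $\mathrm{Cap}(A,B)>0$ and both suprema are attained by the path measure of the harmonic flow $$\Phi_{AB}(dx,dy)=\frac{1}{\mathrm{Cap}(A,B)}\,[h_{AB}(x)-h_{AB}(y)]_+\,K(dx,dy).$$ In detail, let $\nu(C)=\Phi_{AB}(C\times\Omega)$; there is a probability kernel $\ell$ with $\Phi_{AB}(dx,dy)=\nu(dx)\,\ell(x,dy)$, and for every such $\ell$ the Markov chain $(Y_n)_{n\ge0}$ with initial law $\nu(\,\cdot\cap A)$ and transition kernel $\ell$ a.s. reaches $B$, and the law of $(Y_0,\dots,Y_\tau)$ with $\tau=\min\{n\ge1:Y_n\in B\}$ is an element of $\mathcal P^K_{AB}$, is concentrated on self-avoiding paths, has edge measure $\Phi_{AB}$, and attains the value $\mathrm{Cap}(A,B)$. -/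

import Mathlib

open MeasureTheory ProbabilityTheory Set
open scoped ENNReal NNReal

namespace BermanKonsowa

/-! ### Markov chains -/

section MarkovChain

variable {E : Type*} [MeasurableSpace E]

/-- The law, on trajectories `ℕ → E`, of the time-homogeneous Markov chain with transition
probability kernel `p`, as a kernel in the starting point. -/
noncomputable def chainLaw (p : Kernel E E) [IsMarkovKernel p] : Kernel E (ℕ → E) :=
  (Kernel.traj (X := fun _ => E)
    (fun n => p.comap (fun y : (i : Finset.Iic n) → E => y ⟨n, Finset.mem_Iic.2 le_rfl⟩)
      (measurable_pi_apply _)) 0).comap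
    (fun (x : E) (_ : Finset.Iic 0) => x) (measurable_pi_lambda _ fun _ => measurable_id)

instance (p : Kernel E E) [IsMarkovKernel p] : IsMarkovKernel (chainLaw p) := by
  unfold chainLaw; infer_instance

end MarkovChain

variable {Ω : Type*} [MeasurableSpace Ω]

/-! ### The jump process with transition rates `k` -/

/-- All total jump rates `k(x, Ω)` are finite (they may be unbounded in `x`). -/
class FiniteRates (k : Kernel Ω Ω) : Prop where
  lt_top : ∀ x, k x univ < ∞

instance (k : Kernel Ω Ω) [hk : FiniteRates k] : IsSFiniteKernel k := by
  classical
  have hm : Measurable fun x => ⌊(k x univ).toNNReal⌋₊ :=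
    Nat.measurable_floor.comp (k.measurable_coe MeasurableSet.univ).ennreal_toNNReal
  have hs : ∀ n : ℕ, MeasurableSet {x | ⌊(k x univ).toNNReal⌋₊ = n} := fun n =>
    hm (measurableSet_singleton n)
  refine ⟨⟨fun n => Kernel.piecewise (hs n) k 0, fun n => ⟨⟨n + 1, by simp, fun x => ?_⟩⟩, ?_⟩⟩
  · rw [Kernel.piecewise_apply]
    split_ifs with hx
    · have h1 : (k x univ).toNNReal ≤ (n + 1 : ℝ≥0) := by
        have := Nat.lt_floor_add_one (k x univ).toNNReal
        rw [show ⌊(k x univ).toNNReal⌋₊ = n from hx] at this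
        exact this.le
      have h2 := ENNReal.coe_le_coe.2 h1
      rw [ENNReal.coe_toNNReal (hk.lt_top x).ne] at h2
      simpa using h2
    · simp
  · ext x t ht
    rw [Kernel.sum_apply' _ _ ht, tsum_eq_single ⌊(k x univ).toNNReal⌋₊]
    · simp [Kernel.piecewise_apply]
    · intro n hn
      simp [Kernel.piecewise_apply, hn.symm]

/-- The transition kernel of the jump chain: `k(x, dy) / k(x, Ω)` if `k(x, Ω) > 0`, and `δ_x`
if `k(x, Ω) = 0`. -/
noncomputable def jumpKernel (k : Kernel Ω Ω) : Kernel Ω Ω where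
  toFun x := open Classical in
    if k x univ = 0 then Measure.dirac x else (k x univ)⁻¹ • k x
  measurable' := by
    classical
    refine Measurable.ite (k.measurable_coe MeasurableSet.univ (measurableSet_singleton 0))
      Measure.measurable_dirac ?_
    refine Measure.measurable_of_measurable_coe _ fun s hs => ?_
    simp only [Measure.smul_apply, smul_eq_mul]
    exact (k.measurable_coe MeasurableSet.univ).inv.mul (k.measurable_coe hs)

instance (k : Kernel Ω Ω) [hk : FiniteRates k] : IsMarkovKernel (jumpKernel k) := by
  classical
  refine ⟨fun x => ⟨?_⟩⟩
  change (if k x univ = 0 then Measure.dirac x else (k x univ)⁻¹ • k x) univ = 1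
  split_ifs with h
  · simp
  · simp [ENNReal.inv_mul_cancel h (hk.lt_top x).ne]

/-- Sample space of the jump process: the jump chain together with a sequence of clocks. -/
abbrev JumpSample (Ω : Type*) : Type _ := (ℕ → Ω) × (ℕ → ℝ)

/-- The law `ℙ_x`: the jump chain started in `x`, and independent exponential clocks of mean `1`. -/
noncomputable def jumpLaw (k : Kernel Ω Ω) [FiniteRates k] (x : Ω) : Measure (JumpSample Ω) :=
  (chainLaw (jumpKernel k) x).prod (Measure.infinitePi fun _ : ℕ => expMeasure 1)

/-- The time of the `n`-th jump. The holding time in a state `z` is exponential with parameter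
`k(z, Ω)`; it is infinite if `k(z, Ω) = 0`. -/
noncomputable def jumpTime (k : Kernel Ω Ω) (ω : JumpSample Ω) (n : ℕ) : ℝ≥0∞ :=
  ∑ i ∈ Finset.range n, ENNReal.ofReal (ω.2 i) / k (ω.1 i) univ

open Classical in
/-- The minimal jump process `X_t`: it equals the `n`-th state of the jump chain between the `n`-th
and the `(n+1)`-st jump, and `none` (the cemetery) from the explosion time on. -/
noncomputable def jumpProcess (k : Kernel Ω Ω) (ω : JumpSample Ω) (t : ℝ≥0) : Option Ω :=
  if h : ∃ n, jumpTime k ω n ≤ t ∧ (t : ℝ≥0∞) < jumpTime k ω (n + 1) then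
    some (ω.1 (Nat.find h))
  else none

/-- `τ_C = inf {t > 0 : X_t ∈ C}`, with `inf ∅ = ∞`. -/
noncomputable def hittingTime (k : Kernel Ω Ω) (C : Set Ω) (ω : JumpSample Ω) : ℝ≥0∞ :=
  ⨅ (t : ℝ≥0) (_ : 0 < t ∧ ∃ z ∈ C, jumpProcess k ω t = some z), (t : ℝ≥0∞)

/-- Irreducibility with respect to `μ`: each set of positive measure is reached with positive
probability from almost every starting point. -/
def IsIrreducible (k : Kernel Ω Ω) [FiniteRates k] (μ : Measure Ω) : Prop :=
  ∀ C : Set Ω, MeasurableSet C → μ C ≠ 0 →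
    ∀ᵐ x ∂μ, jumpLaw k x {ω | hittingTime k C ω < ∞} ≠ 0

/-! ### Conductance, harmonic function, capacity -/

/-- The conductance measure `K(dx, dy) = μ(dx) k(x, dy)`. -/
noncomputable def conductance (μ : Measure Ω) (k : Kernel Ω Ω) : Measure (Ω × Ω) := μ ⊗ₘ k

/-- The generator `(L f)(x) = ∫ (f(y) - f(x)) k(x, dy)`. -/
noncomputable def generator (k : Kernel Ω Ω) (f : Ω → ℝ) (x : Ω) : ℝ :=
  ∫ y, (f y - f x) ∂(k x)

open Classical in
/-- `h_AB`: equal to `1` on `A`, to `0` on `B`, and to `ℙ_x(τ_A < τ_B)` elsewhere. -/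
noncomputable def harmonic (k : Kernel Ω Ω) [FiniteRates k] (A B : Set Ω) (x : Ω) : ℝ :=
  if x ∈ A then 1 else if x ∈ B then 0 else
    (jumpLaw k x).real {ω | hittingTime k A ω < hittingTime k B ω}

/-- `Cap(A, B) = ∫_A (-L h_AB) dμ`. -/
noncomputable def capacity (μ : Measure Ω) (k : Kernel Ω Ω) [FiniteRates k] (A B : Set Ω) : ℝ :=
  ∫ x in A, -generator k (harmonic k A B) x ∂μ

/-! ### Paths and their edge measures -/

/-- Finite sequences `(γ_0, …, γ_n)`, `n ∈ ℕ`. -/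
abbrev FinPath (Ω : Type*) : Type _ := Σ n : ℕ, Fin (n + 1) → Ω

/-- `Γ_AB`: the paths that start in `A`, end in `B`, and are outside `B` at the times strictly
between `0` and the last one. -/
def pathsBetween (A B : Set Ω) : Set (FinPath Ω) :=
  {γ | γ.2 0 ∈ A ∧ γ.2 (Fin.last γ.1) ∈ B ∧
    ∀ i : Fin (γ.1 + 1), i ≠ 0 → i ≠ Fin.last γ.1 → γ.2 i ∉ B}

/-- The self-avoiding paths. -/
def selfAvoiding : Set (FinPath Ω) := {γ | Function.Injective γ.2}

/-- The `j`-th edge of a path. -/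
def edge (γ : FinPath Ω) (j : Fin γ.1) : Ω × Ω := (γ.2 j.castSucc, γ.2 j.succ)

/-- The counting measure of the edges of a path (with multiplicity). -/
noncomputable def edgeCount (γ : FinPath Ω) : Measure (Ω × Ω) :=
  ∑ j : Fin γ.1, Measure.dirac (edge γ j)

/-- The edge measure `Φ_P`: `Φ_P(D)` is the expected number of edges of the random path that
lie in `D`. -/
noncomputable def edgeMeasure (P : Measure (FinPath Ω)) : Measure (Ω × Ω) := P.bind edgeCount

theorem measurable_edgeCount : Measurable (edgeCount : FinPath Ω → Measure (Ω × Ω)) := by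
  intro s hs
  refine MeasurableSpace.measurableSet_iInf.2 fun n => ?_
  have : Measurable fun g : Fin (n + 1) → Ω => edgeCount (⟨n, g⟩ : FinPath Ω) := by
    refine Measure.measurable_of_measurable_coe _ fun D hD => ?_
    simp only [edgeCount, Measure.coe_finsetSum, Finset.sum_apply]
    change Measurable fun g : Fin (n + 1) → Ω =>
      ∑ j : Fin n, Measure.dirac ((g j.castSucc, g j.succ) : Ω × Ω) D
    refine Finset.measurable_fun_sum _ fun j _ => ?_
    refine (Measure.measurable_coe hD).comp (Measure.measurable_dirac.comp ?_)
    exact (measurable_pi_apply (X := fun _ : Fin (n + 1) => Ω) _).prodMk (measurable_pi_apply _)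
  exact this hs

/-- The defining property of the edge measure. -/
theorem lintegral_edgeMeasure (P : Measure (FinPath Ω)) {f : Ω × Ω → ℝ≥0∞} (hf : Measurable f) :
    ∫⁻ z, f z ∂(edgeMeasure P) = ∫⁻ γ, ∑ j : Fin γ.1, f (edge γ j) ∂P := by
  rw [edgeMeasure, Measure.lintegral_bind measurable_edgeCount.aemeasurable hf.aemeasurable]
  refine lintegral_congr fun γ => ?_
  simp [edgeCount, lintegral_finsetSum_measure, lintegral_dirac' _ hf]

/-- `𝒫_AB^K`: the probability measures on `Γ_AB` whose edge measure is absolutely continuous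
with respect to `K`. -/
def admissible (K : Measure (Ω × Ω)) (A B : Set Ω) : Set (Measure (FinPath Ω)) :=
  {P | IsProbabilityMeasure P ∧ (∀ᵐ γ ∂P, γ ∈ pathsBetween A B) ∧ edgeMeasure P ≪ K}

/-- `E[(∑_{(x,y) ∈ γ} dΦ_P/dK (x,y))⁻¹]`, an expectation with values in `[0, ∞]`. -/
noncomputable def pathValue (K : Measure (Ω × Ω)) (P : Measure (FinPath Ω)) : ℝ≥0∞ :=
  ∫⁻ γ, (∑ j : Fin γ.1, (edgeMeasure P).rnDeriv K (edge γ j))⁻¹ ∂P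

/-! ### The harmonic flow and its path measure -/

/-- `Φ_AB(dx, dy) = Cap(A,B)⁻¹ [h_AB(x) - h_AB(y)]₊ K(dx, dy)`. -/
noncomputable def harmonicFlow (μ : Measure Ω) (k : Kernel Ω Ω) [FiniteRates k] (A B : Set Ω) :
    Measure (Ω × Ω) :=
  (ENNReal.ofReal (capacity μ k A B))⁻¹ •
    (conductance μ k).withDensity
      fun z => ENNReal.ofReal (harmonic k A B z.1 - harmonic k A B z.2)

/-- `ℓ` is a probability kernel with `Φ(dx, dy) = ν(dx) ℓ(x, dy)`, `ν` the left marginal of `Φ`. -/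
def Disintegrates (Φ : Measure (Ω × Ω)) (ℓ : Kernel Ω Ω) : Prop :=
  IsMarkovKernel ℓ ∧ Φ = Φ.fst ⊗ₘ ℓ

/-- The law of the Markov chain `Y` with initial law `ν(· ∩ A)`, `ν` the left marginal of `Φ`, and
transition kernel `ℓ`. -/
noncomputable def flowChainLaw (Φ : Measure (Ω × Ω)) (A : Set Ω) (ℓ : Kernel Ω Ω)
    [IsMarkovKernel ℓ] : Measure (ℕ → Ω) :=
  (Φ.fst.restrict A).bind (chainLaw ℓ)

/-- `τ_B^Y = min {n ≥ 1 : Y_n ∈ B}` (and `0` if there is no such `n`). -/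
noncomputable def hitIndex (B : Set Ω) (y : ℕ → Ω) : ℕ := sInf {n | 1 ≤ n ∧ y n ∈ B}

/-- The path `(Y_0, …, Y_τ)`, `τ = τ_B^Y`. -/
noncomputable def stoppedPath (B : Set Ω) (y : ℕ → Ω) : FinPath Ω :=
  ⟨hitIndex B y, fun i => y i⟩

/-- The law of the chain associated with the flow `Φ`, stopped when it reaches `B`. -/
noncomputable def flowPathLaw (Φ : Measure (Ω × Ω)) (A B : Set Ω) (ℓ : Kernel Ω Ω)
    [IsMarkovKernel ℓ] : Measure (FinPath Ω) :=
  (flowChainLaw Φ A ℓ).map (stoppedPath B)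

theorem measurable_hitIndex {B : Set Ω} (hB : MeasurableSet B) :
    Measurable (hitIndex B : (ℕ → Ω) → ℕ) := by
  classical
  refine measurable_to_countable' fun n => ?_
  have hS : ∀ m : ℕ, MeasurableSet {y : ℕ → Ω | 1 ≤ m ∧ y m ∈ B} := fun m =>
    (MeasurableSet.const _).inter (measurable_pi_apply m hB)
  have key : (hitIndex B : (ℕ → Ω) → ℕ) ⁻¹' {n} =
      ({y | 1 ≤ n ∧ y n ∈ B} ∩ ⋂ m ∈ Finset.range n, {y | 1 ≤ m ∧ y m ∈ B}ᶜ) ∪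
        ({_y | n = 0} ∩ ⋂ m : ℕ, {y | 1 ≤ m ∧ y m ∈ B}ᶜ) := by
    ext y
    simp only [mem_preimage, mem_singleton_iff, mem_union, mem_inter_iff, mem_ofPred_eq, mem_iInter,
      mem_compl_iff, Finset.mem_range]
    constructor
    · rintro rfl
      rcases Set.eq_empty_or_nonempty {n | 1 ≤ n ∧ y n ∈ B} with h | h
      · refine Or.inr ⟨by simp [hitIndex, h], fun m hm => ?_⟩
        have : m ∈ {n | 1 ≤ n ∧ y n ∈ B} := hm
        simp [h] at this
      · exact Or.inl ⟨Nat.sInf_mem h, fun m hm => Nat.notMem_of_lt_sInf hm⟩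
    · rintro (⟨h1, h2⟩ | ⟨rfl, h⟩)
      · refine le_antisymm (Nat.sInf_le h1) ?_
        by_contra! hlt
        exact h2 _ hlt (Nat.sInf_mem (s := {n | 1 ≤ n ∧ y n ∈ B}) ⟨n, h1⟩)
      · have : {n | 1 ≤ n ∧ y n ∈ B} = ∅ := Set.eq_empty_of_forall_notMem fun m hm => h m hm
        simp [hitIndex, this]
  rw [key]
  exact ((hS n).inter (Finset.measurableSet_biInter _ fun m _ => (hS m).compl)).union
    ((MeasurableSet.const _).inter (MeasurableSet.iInter fun m => (hS m).compl))

theorem measurable_stoppedPath {B : Set Ω} (hB : MeasurableSet B) :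
    Measurable (stoppedPath B : (ℕ → Ω) → FinPath Ω) := by
  intro s hs
  have key : (stoppedPath B : (ℕ → Ω) → FinPath Ω) ⁻¹' s =
      ⋃ n : ℕ, hitIndex B ⁻¹' {n} ∩
        (fun (y : ℕ → Ω) (i : Fin (n + 1)) => y i) ⁻¹' ((fun g => (⟨n, g⟩ : FinPath Ω)) ⁻¹' s) := by
    ext y
    simp [stoppedPath]
  rw [key]
  refine MeasurableSet.iUnion fun n => (measurable_hitIndex hB (measurableSet_singleton n)).inter ?_
  exact (measurable_pi_lambda _ fun i => measurable_pi_apply _)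
    (MeasurableSpace.measurableSet_iInf.1 hs n)

end BermanKonsowa

open BermanKonsowa

/-! Up to a `μ`-null set, `h_AB` is the probability `H` that the jump chain meets `A` before `B`
(`harmonic_ae_eq`), so continuous time can be dropped. `H` solves a Dirichlet problem for the
symmetric conductance `K`, and summation by parts identifies the energy `∫ (H x - H y)₊² dK` with
the flow out of `A`, which is the capacity (`IsPotential.lintegral_sq`).

Upper bound (`pathValue_le`): along a path from `A` to `B` the truncated drops of `H` add up to at
least `1`, so Cauchy-Schwarz bounds the inverse of `∑ φ`, with `φ = dΦ_P/dK`, by `∑ (H x - H y)₊² /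
φ`. In expectation this is an integral against `Φ_P = φ K`; the density cancels and the energy
remains.

Attainment: Kirchhoff's law (`IsPotential.lintegral_flow_balance`) says that the normalized flow `Φ`
has its sources in `A` and its sinks in `B`. The occupation measures of its chain sum to a part of
the left marginal of `Φ`. The rest would be a finite measure invariant under the killed step,
impossible since every edge strictly decreases `H` (`sum_occupation_eq_fst`). Hence the stopped
chain has edge measure `Φ`, and along its paths the densities telescope to the constant `1 / Cap`,
which gives the value `Cap`. Strict decrease also excludes self-intersections.

Irreducibility enters only to show that the flow is nonzero (`outFlow_ne_zero`). If `A` or `B` is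
`μ`-null, both sides of the formula vanish. -/

namespace BermanKonsowa

/-! ### Markov property and hitting probabilities of discrete-time chains. -/

section Chain

variable {E : Type*} [MeasurableSpace E]

/-- Markov property at time `n`: the law of the first `n + 1` coordinates, composed with one further
transition, is the law of the first `n + 2`. -/
theorem lintegral_chainLaw_succ (p : Kernel E E) [IsMarkovKernel p] (x : E) (n : ℕ)
    {F : ((i : Finset.Iic n) → E) → ℝ≥0∞} (hF : Measurable F)
    {g : E × E → ℝ≥0∞} (hg : Measurable g) :
    ∫⁻ y, F (Preorder.frestrictLe n y) * g (y n, y (n + 1)) ∂(chainLaw p x) =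
      ∫⁻ y, F (Preorder.frestrictLe n y) * ∫⁻ z, g (y n, z) ∂(p (y n)) ∂(chainLaw p x) := by
  set κ : (n : ℕ) → Kernel ((i : Finset.Iic n) → E) E := fun n =>
    p.comap (fun y : (i : Finset.Iic n) → E => y ⟨n, Finset.mem_Iic.2 le_rfl⟩)
      (measurable_pi_apply _) with hκ
  have hlaw : chainLaw p x = Kernel.traj (X := fun _ => E) κ 0 (fun _ => x) := rfl
  have key := Kernel.partialTraj_compProd_eq_map_traj (X := fun _ => E) (κ := κ) (zero_le (a := n))
    (x₀ := fun _ => x)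
  rw [← Kernel.traj_map_frestrictLe_apply, ← hlaw] at key
  have hG : Measurable fun z : ((i : Finset.Iic n) → E) × E =>
      F z.1 * g (z.1 ⟨n, Finset.mem_Iic.2 le_rfl⟩, z.2) := by fun_prop
  have h1 := congrArg (fun m => ∫⁻ z, F z.1 * g (z.1 ⟨n, Finset.mem_Iic.2 le_rfl⟩, z.2) ∂m) key
  rw [lintegral_map hG (by fun_prop), Measure.lintegral_compProd hG, lintegral_map
    hG.lintegral_kernel_prod_right' (by fun_prop)] at h1
  refine h1.symm.trans (lintegral_congr fun y => ?_)
  exact lintegral_const_mul (F (Preorder.frestrictLe n y)) (f := fun z => g (y n, z)) (by fun_prop)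

theorem map_eval_zero_chainLaw (p : Kernel E E) [IsMarkovKernel p] (x : E) :
    (chainLaw p x).map (fun y => y 0) = Measure.dirac x := by
  set κ : (n : ℕ) → Kernel ((i : Finset.Iic n) → E) E := fun n =>
    p.comap (fun y : (i : Finset.Iic n) → E => y ⟨n, Finset.mem_Iic.2 le_rfl⟩)
      (measurable_pi_apply _) with hκ
  have hlaw : chainLaw p x = Kernel.traj (X := fun _ => E) κ 0 (fun _ => x) := rfl
  have key := Kernel.traj_map_frestrictLe_apply (X := fun _ => E) (κ := κ) 0 0 (fun _ => x)
  rw [Kernel.partialTraj_self, Kernel.id_apply, ← hlaw] at key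
  have h2 : (fun y : ℕ → E => y 0) =
      (fun z : (i : Finset.Iic 0) → E => z ⟨0, Finset.mem_Iic.2 le_rfl⟩) ∘
        Preorder.frestrictLe (π := fun _ => E) 0 := rfl
  rw [h2, ← Measure.map_map (by fun_prop) (by fun_prop), key, Measure.map_dirac' (by fun_prop)]

/-- The transition operator of `p`, killed outside `D`. -/
noncomputable def killedOperator (p : Kernel E E) (D : Set E) (f : E → ℝ≥0∞) : E → ℝ≥0∞ :=
  D.indicator fun x => ∫⁻ y, f y ∂(p x)

theorem measurable_killedOperator (p : Kernel E E) {D : Set E} (hD : MeasurableSet D)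
    {f : E → ℝ≥0∞} (hf : Measurable f) : Measurable (killedOperator p D f) :=
  hf.lintegral_kernel.indicator hD

theorem measurable_killedOperator_iterate (p : Kernel E E) {D : Set E} (hD : MeasurableSet D)
    {f : E → ℝ≥0∞} (hf : Measurable f) (n : ℕ) : Measurable ((killedOperator p D)^[n] f) := by
  induction n with
  | zero => exact hf
  | succ n ih =>
    rw [Function.iterate_succ_apply']
    exact measurable_killedOperator p hD ih

/-- The Markov property integrates out the last step, so the killed operator is applied innermost;
the induction therefore varies `f`. -/
theorem lintegral_chainLaw_prod_indicator (p : Kernel E E) [IsMarkovKernel p] {D : Set E}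
    (hD : MeasurableSet D) (x : E) (n : ℕ) {f : E → ℝ≥0∞} (hf : Measurable f) :
    ∫⁻ y, (∏ i ∈ Finset.range n, D.indicator 1 (y i)) * f (y n) ∂(chainLaw p x) =
      (killedOperator p D)^[n] f x := by
  have h1 : Measurable (D.indicator (1 : E → ℝ≥0∞)) := measurable_one.indicator hD
  induction n generalizing f with
  | zero =>
    have := lintegral_map (μ := chainLaw p x) hf (g := fun y : ℕ → E => y 0) (by fun_prop)
    rw [map_eval_zero_chainLaw, lintegral_dirac' _ hf] at this
    simpa using this.symm
  | succ n ih =>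
    rw [Function.iterate_succ_apply, ← ih (measurable_killedOperator p hD hf)]
    have := lintegral_chainLaw_succ p x n
      (F := fun z => (∏ i ∈ (Finset.range (n + 1)).attach,
        D.indicator (1 : E → ℝ≥0∞) (z ⟨i, Finset.mem_Iic.2 (Nat.lt_succ_iff.1 (Finset.mem_range.1 i.2))⟩)))
      (by fun_prop) (g := fun z => f z.2) (by fun_prop)
    simp only [Preorder.frestrictLe_apply] at this
    have h2 : ∀ y : ℕ → E, ∏ i ∈ (Finset.range (n + 1)).attach, D.indicator (1 : E → ℝ≥0∞) (y i) =
      ∏ i ∈ Finset.range (n + 1), D.indicator (1 : E → ℝ≥0∞) (y i) := fun y =>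
        Finset.prod_attach _ (fun i => D.indicator (1 : E → ℝ≥0∞) (y i))
    simp only [h2] at this
    rw [this]
    refine lintegral_congr fun y => ?_
    rw [Finset.prod_range_succ, mul_assoc]
    congr 1
    by_cases h : y n ∈ D <;> simp [killedOperator, h]

/-- The probability to reach `A` at a time up to which the chain has been in `D`. -/
noncomputable def hitProb (p : Kernel E E) (D A : Set E) (x : E) : ℝ≥0∞ :=
  ∑' n, (killedOperator p D)^[n] (A.indicator 1) x

theorem measurable_hitProb (p : Kernel E E) {D A : Set E} (hD : MeasurableSet D)
    (hA : MeasurableSet A) : Measurable (hitProb p D A) :=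
  Measurable.tsum fun n =>
    measurable_killedOperator_iterate p hD (measurable_one.indicator hA) n

/-- The trajectories that reach `A` at a time up to which they have been in `D`. -/
def hitEvent (D A : Set E) : Set (ℕ → E) := {y | ∃ n, (∀ i < n, y i ∈ D) ∧ y n ∈ A}

theorem measurableSet_hitEvent_time {D A : Set E} (hD : MeasurableSet D) (hA : MeasurableSet A)
    (n : ℕ) : MeasurableSet {y : ℕ → E | (∀ i < n, y i ∈ D) ∧ y n ∈ A} := by
  have : {y : ℕ → E | (∀ i < n, y i ∈ D) ∧ y n ∈ A} =
      (⋂ i ∈ Finset.range n, (fun y : ℕ → E => y i) ⁻¹' D) ∩ (fun y : ℕ → E => y n) ⁻¹' A := by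
    ext y; simp
  rw [this]
  exact (Finset.measurableSet_biInter _ fun i _ => measurable_pi_apply i hD).inter
    (measurable_pi_apply n hA)

theorem chainLaw_hitEvent_time (p : Kernel E E) [IsMarkovKernel p] {D A : Set E}
    (hD : MeasurableSet D) (hA : MeasurableSet A) (x : E) (n : ℕ) :
    chainLaw p x {y | (∀ i < n, y i ∈ D) ∧ y n ∈ A} =
      (killedOperator p D)^[n] (A.indicator 1) x := by
  rw [← lintegral_chainLaw_prod_indicator p hD x n (measurable_one.indicator hA),
    ← lintegral_indicator_one (measurableSet_hitEvent_time hD hA n)]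
  refine lintegral_congr fun y => ?_
  by_cases h : ∀ i < n, y i ∈ D
  · rw [Finset.prod_eq_one fun i hi => by simp [h i (Finset.mem_range.1 hi)], one_mul]
    by_cases hy : y n ∈ A
    · rw [indicator_of_mem (show y ∈ {y : ℕ → E | (∀ i < n, y i ∈ D) ∧ y n ∈ A} from ⟨h, hy⟩)]
      simp [hy]
    · rw [indicator_of_notMem (s := {y : ℕ → E | (∀ i < n, y i ∈ D) ∧ y n ∈ A}) fun h' => hy h'.2]
      simp [hy]
  · rw [indicator_of_notMem (s := {y : ℕ → E | (∀ i < n, y i ∈ D) ∧ y n ∈ A}) fun h' => h h'.1]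
    push Not at h
    obtain ⟨i, hi, hiD⟩ := h
    rw [Finset.prod_eq_zero (Finset.mem_range.2 hi) (by simp [hiD]), zero_mul]

theorem chainLaw_hitEvent (p : Kernel E E) [IsMarkovKernel p] {D A : Set E}
    (hD : MeasurableSet D) (hA : MeasurableSet A) (hDA : Disjoint D A) (x : E) :
    chainLaw p x (hitEvent D A) = hitProb p D A x := by
  have : hitEvent D A = ⋃ n, {y : ℕ → E | (∀ i < n, y i ∈ D) ∧ y n ∈ A} := by
    ext y; simp [hitEvent]
  rw [this, measure_iUnion _ fun n => measurableSet_hitEvent_time hD hA n]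
  · exact tsum_congr fun n => chainLaw_hitEvent_time p hD hA x n
  -- Since `D` and `A` are disjoint, the time in the event is the first visit to `A`, hence unique.
  · have aux : ∀ (y : ℕ → E) (m n : ℕ), m < n → ((∀ i < n, y i ∈ D) ∧ y n ∈ A) →
        ((∀ i < m, y i ∈ D) ∧ y m ∈ A) → False := fun y m n hmn h1 h2 =>
      hDA.le_bot ⟨h1.1 m hmn, h2.2⟩
    intro m n hmn
    refine Set.disjoint_left.2 fun y h1 h2 => ?_
    rcases hmn.lt_or_gt with h | h
    · exact aux y m n h h2 h1
    · exact aux y n m h h1 h2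

theorem hitProb_le_one (p : Kernel E E) [IsMarkovKernel p] {D A : Set E}
    (hD : MeasurableSet D) (hA : MeasurableSet A) (hDA : Disjoint D A) (x : E) :
    hitProb p D A x ≤ 1 := by
  rw [← chainLaw_hitEvent p hD hA hDA]
  exact prob_le_one

theorem hitProb_eq (p : Kernel E E) {D A : Set E}
    (hD : MeasurableSet D) (hA : MeasurableSet A) (x : E) :
    hitProb p D A x = A.indicator 1 x + killedOperator p D (hitProb p D A) x := by
  unfold hitProb
  rw [tsum_eq_zero_add' ENNReal.summable]
  congr 1
  simp only [Function.iterate_succ_apply']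
  by_cases h : x ∈ D
  · simp only [killedOperator, indicator_of_mem h]
    exact (lintegral_tsum fun n => (measurable_killedOperator_iterate p hD
      (measurable_one.indicator hA) n).aemeasurable).symm
  · simp [killedOperator, h]

/-- With no killing, `hitProb` is the expected number of visits and not a probability; the union
bound suffices to detect null events. -/
theorem chainLaw_exists_mem_le (p : Kernel E E) [IsMarkovKernel p] {A : Set E}
    (hA : MeasurableSet A) (x : E) :
    chainLaw p x {y | ∃ n, y n ∈ A} ≤ hitProb p univ A x := by
  have : {y : ℕ → E | ∃ n, y n ∈ A} = ⋃ n, {y : ℕ → E | (∀ i < n, y i ∈ univ) ∧ y n ∈ A} := by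
    ext y; simp
  rw [this]
  refine (measure_iUnion_le _).trans (ENNReal.tsum_le_tsum fun n => ?_)
  rw [chainLaw_hitEvent_time p MeasurableSet.univ hA]

/-- A set that is not entered from a set `S` almost everywhere is not reached from `S`. -/
theorem hitProb_univ_eq_zero (p : Kernel E E) {μ : Measure E} {A S : Set E}
    (hnull : ∀ N : Set E, μ N = 0 → ∀ᵐ x ∂μ, p x N = 0)
    (hS : ∀ᵐ x ∂μ, x ∈ S → p x Sᶜ = 0) (hAS : ∀ x ∈ S, x ∉ A) :
    ∀ᵐ x ∂μ, x ∈ S → hitProb p univ A x = 0 := by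
  have key : ∀ n, ∀ᵐ x ∂μ, x ∈ S → (killedOperator p univ)^[n] (A.indicator 1) x = 0 := by
    intro n
    induction n with
    | zero => exact Filter.Eventually.of_forall fun x hx => by simp [hAS x hx]
    | succ n ih =>
      simp only [Function.iterate_succ_apply']
      filter_upwards [hnull _ ih, hS] with x h1 h2 hx
      simp only [killedOperator, indicator_univ]
      have h1' : ∀ᵐ y ∂(p x), y ∈ S → (killedOperator p univ)^[n] (A.indicator 1) y = 0 := h1
      have h2' : ∀ᵐ y ∂(p x), y ∈ S := h2 hx
      refine (lintegral_congr_ae (g := 0) ?_).trans (by simp)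
      filter_upwards [h1', h2'] with y h3 h4 using h3 h4
  filter_upwards [ae_all_iff.2 key] with x hx hxS
  simp [hitProb, fun n => hx n hxS]

end Chain

variable {Ω : Type*} [MeasurableSpace Ω]

/-! ### From the jump process to its embedded chain. -/

section JumpProcess

theorem rate_smul_jumpKernel (k : Kernel Ω Ω) [hk : FiniteRates k] (x : Ω) :
    k x univ • jumpKernel k x = k x := by
  classical
  change k x univ • (if k x univ = 0 then Measure.dirac x else (k x univ)⁻¹ • k x) = k x
  split_ifs with h
  · rw [h, zero_smul, Measure.measure_univ_eq_zero.1 h]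
  · rw [smul_smul, ENNReal.mul_inv_cancel h (hk.lt_top x).ne, one_smul]

theorem jumpTime_zero (k : Kernel Ω Ω) (ω : JumpSample Ω) : jumpTime k ω 0 = 0 := by
  simp [jumpTime]

theorem jumpTime_succ (k : Kernel Ω Ω) (ω : JumpSample Ω) (n : ℕ) :
    jumpTime k ω (n + 1) = jumpTime k ω n + ENNReal.ofReal (ω.2 n) / k (ω.1 n) univ :=
  Finset.sum_range_succ _ _

theorem jumpTime_ne_top (k : Kernel Ω Ω) {ω : JumpSample Ω}
    (hr : ∀ i, 0 < k (ω.1 i) univ) (n : ℕ) : jumpTime k ω n ≠ ∞ := by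
  refine (ENNReal.sum_lt_top.2 fun i _ => ?_).ne
  exact ENNReal.div_lt_top ENNReal.ofReal_ne_top (hr i).ne'

theorem strictMono_jumpTime (k : Kernel Ω Ω) [hk : FiniteRates k] {ω : JumpSample Ω}
    (hr : ∀ i, 0 < k (ω.1 i) univ) (hc : ∀ i, 0 < ω.2 i) : StrictMono (jumpTime k ω) := by
  refine strictMono_nat_of_lt_succ fun n => ?_
  rw [jumpTime_succ]
  exact ENNReal.lt_add_right (jumpTime_ne_top k hr n)
    (ENNReal.div_pos (ENNReal.ofReal_pos.2 (hc n)).ne' (hk.lt_top _).ne).ne'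

theorem exists_of_jumpProcess_eq_some (k : Kernel Ω Ω) {ω : JumpSample Ω} {t : ℝ≥0} {z : Ω}
    (h : jumpProcess k ω t = some z) : ∃ n, jumpTime k ω n ≤ t ∧ ω.1 n = z := by
  classical
  unfold jumpProcess at h
  split_ifs at h with hn
  exact ⟨_, (Nat.find_spec hn).1, Option.some_injective _ h⟩

theorem exists_mem_of_hittingTime_lt_top (k : Kernel Ω Ω) {C : Set Ω} {ω : JumpSample Ω}
    (h : hittingTime k C ω < ∞) : ∃ n, ω.1 n ∈ C := by
  simp only [hittingTime, iInf_lt_iff] at h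
  obtain ⟨t, ⟨-, z, hz, hX⟩, -⟩ := h
  obtain ⟨n, -, rfl⟩ := exists_of_jumpProcess_eq_some k hX
  exact ⟨n, hz⟩

theorem jumpTime_le_hittingTime (k : Kernel Ω Ω) {C : Set Ω} {ω : JumpSample Ω}
    (hmono : Monotone (jumpTime k ω)) {n : ℕ} (h : ∀ i < n, ω.1 i ∉ C) :
    jumpTime k ω n ≤ hittingTime k C ω := by
  refine le_iInf₂ fun t ht => ?_
  obtain ⟨-, z, hz, hX⟩ := ht
  obtain ⟨m, hm, rfl⟩ := exists_of_jumpProcess_eq_some k hX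
  by_contra! hlt
  exact h m (lt_of_not_ge fun hnm => (hm.trans_lt hlt).not_ge (hmono hnm)) hz

theorem hittingTime_le_jumpTime (k : Kernel Ω Ω) {C : Set Ω} {ω : JumpSample Ω}
    (hmono : StrictMono (jumpTime k ω)) {n : ℕ} (hn : 0 < n) (h : ω.1 n ∈ C) :
    hittingTime k C ω ≤ jumpTime k ω n := by
  classical
  have hlt : jumpTime k ω n < jumpTime k ω (n + 1) := hmono n.lt_succ_self
  have htop : jumpTime k ω n ≠ ∞ := (hlt.trans_le le_top).ne
  have hcoe : ((jumpTime k ω n).toNNReal : ℝ≥0∞) = jumpTime k ω n := ENNReal.coe_toNNReal htop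
  have h0 : 0 < jumpTime k ω n := by
    rw [← jumpTime_zero k ω]; exact hmono hn
  refine (iInf₂_le (jumpTime k ω n).toNNReal
    ⟨ENNReal.toNNReal_pos h0.ne' htop, ω.1 n, h, ?_⟩).trans hcoe.le
  have hex : ∃ m, jumpTime k ω m ≤ ((jumpTime k ω n).toNNReal : ℝ≥0∞) ∧
      ((jumpTime k ω n).toNNReal : ℝ≥0∞) < jumpTime k ω (m + 1) := by
    rw [hcoe]; exact ⟨n, le_rfl, hlt⟩
  -- The intervals between successive jumps are disjoint, so the index selected in `jumpProcess` is
  -- `n`.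
  have hfind : Nat.find hex = n := by
    have hs := Nat.find_spec hex
    generalize Nat.find hex = m at hs ⊢
    rw [hcoe, hmono.le_iff_le, hmono.lt_iff_lt] at hs
    omega
  unfold jumpProcess
  rw [dif_pos hex, hfind]

/-- Every visit of the process happens at some index of the chain, so explosion plays no role, and
strictly increasing jump times let times be compared through indices. Starting outside `A ∪ B` makes
the first relevant index positive. -/
theorem hittingTime_lt_iff (k : Kernel Ω Ω) {A B : Set Ω} (hAB : Disjoint A B)
    {ω : JumpSample Ω} (hmono : StrictMono (jumpTime k ω)) (h0 : ω.1 0 ∉ A ∪ B) :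
    hittingTime k A ω < hittingTime k B ω ↔ ω.1 ∈ hitEvent (A ∪ B)ᶜ A := by
  classical
  have hpos : ∀ {n : ℕ}, ω.1 n ∈ A ∪ B → 0 < n := fun {n} hn =>
    Nat.pos_of_ne_zero fun h => h0 (h ▸ hn)
  constructor
  · intro h
    have hex := exists_mem_of_hittingTime_lt_top k (h.trans_le le_top)
    refine ⟨Nat.find hex, fun i hi hiAB => ?_, Nat.find_spec hex⟩
    rcases hiAB with hiA | hiB
    · exact Nat.find_min hex hi hiA
    · have h1 := hittingTime_le_jumpTime k hmono (hpos (Or.inr hiB)) hiB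
      have h2 := jumpTime_le_hittingTime k hmono.monotone (C := A) (n := Nat.find hex)
        fun j hj => Nat.find_min hex hj
      exact absurd ((h.trans_le h1).trans_le (hmono.monotone hi.le)) h2.not_gt
  · rintro ⟨n, hD, hA⟩
    refine (hittingTime_le_jumpTime k hmono (hpos (Or.inl hA)) hA).trans_lt
      ((hmono n.lt_succ_self).trans_le (jumpTime_le_hittingTime k hmono.monotone fun i hi hiB => ?_))
    rcases (Nat.lt_succ_iff.1 hi).lt_or_eq with h | rfl
    · exact hD i h (Or.inr hiB)
    · exact hAB.le_bot ⟨hA, hiB⟩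

theorem ae_expMeasure_pos {r : ℝ} : ∀ᵐ t ∂(expMeasure r), 0 < t := by
  have h : expMeasure r (Iic 0) = 0 := by
    rw [expMeasure, gammaMeasure, withDensity_apply _ measurableSet_Iic,
      ← setLIntegral_congr Iio_ae_eq_Iic, lintegral_gammaPDF_of_nonpos le_rfl]
  rw [ae_iff]
  simpa [Iic] using h

theorem ae_clocks_pos :
    ∀ᵐ c ∂(Measure.infinitePi fun _ : ℕ => expMeasure 1), ∀ i, 0 < c i := by
  have : IsProbabilityMeasure (expMeasure 1) := isProbabilityMeasure_expMeasure one_pos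
  refine ae_all_iff.2 fun i => ?_
  have h := ae_expMeasure_pos (r := 1)
  rw [← Measure.infinitePi_map_eval (μ := fun _ : ℕ => expMeasure 1) i] at h
  exact ae_of_ae_map (measurable_pi_apply i).aemeasurable h

theorem jumpLaw_fst_preimage (k : Kernel Ω Ω) [FiniteRates k] (x : Ω) (S : Set (ℕ → Ω)) :
    jumpLaw k x (Prod.fst ⁻¹' S) = chainLaw (jumpKernel k) x S := by
  have : IsProbabilityMeasure (expMeasure 1) := isProbabilityMeasure_expMeasure one_pos
  rw [jumpLaw, ← prod_univ, Measure.prod_prod, measure_univ, mul_one]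

theorem conductance_prod_univ_eq_zero {μ : Measure Ω} [SFinite μ] (k : Kernel Ω Ω) [FiniteRates k]
    {N : Set Ω} (hN : μ N = 0) :
    conductance μ k (N ×ˢ univ) = 0 := by
  refine measure_mono_null (prod_mono_left (subset_toMeasurable μ N)) ?_
  rw [conductance, Measure.compProd_apply_prod (measurableSet_toMeasurable μ N) MeasurableSet.univ]
  exact setLIntegral_measure_zero _ _ (by rw [measure_toMeasurable, hN])

theorem conductance_univ_prod_eq_zero {μ : Measure Ω} [SFinite μ] {k : Kernel Ω Ω}
    [FiniteRates k]
    (hrev : (conductance μ k).map Prod.swap = conductance μ k) {N : Set Ω} (hN : μ N = 0) :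
    conductance μ k (univ ×ˢ N) = 0 := by
  have hM := measurableSet_toMeasurable μ N
  refine measure_mono_null (prod_mono_right (subset_toMeasurable μ N)) ?_
  rw [← hrev, Measure.map_apply measurable_swap (MeasurableSet.univ.prod hM), preimage_swap_prod]
  exact conductance_prod_univ_eq_zero k (by rwa [measure_toMeasurable])

/-- By symmetry of `K`, the null set may be moved to the second coordinate. This lets
almost-everywhere statements survive a step of the chain. -/
theorem ae_jumpKernel_eq_zero {k : Kernel Ω Ω} [hk : FiniteRates k] {μ : Measure Ω} [SFinite μ]
    (hrev : (conductance μ k).map Prod.swap = conductance μ k)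
    (hpos : ∀ᵐ x ∂μ, 0 < k x univ) {N : Set Ω} (hN : μ N = 0) :
    (∀ᵐ x ∂μ, k x N = 0) ∧ ∀ᵐ x ∂μ, jumpKernel k x N = 0 := by
  have hM := measurableSet_toMeasurable μ N
  have h2 : conductance μ k (univ ×ˢ toMeasurable μ N) = 0 :=
    conductance_univ_prod_eq_zero hrev (by rwa [measure_toMeasurable])
  rw [conductance, Measure.compProd_apply_prod MeasurableSet.univ hM, Measure.restrict_univ,
    lintegral_eq_zero_iff (k.measurable_coe hM)] at h2
  have h3 : ∀ᵐ x ∂μ, k x N = 0 :=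
    h2.mono fun x hx => measure_mono_null (subset_toMeasurable μ N) hx
  refine ⟨h3, ?_⟩
  filter_upwards [h3, hpos] with x hx hx0
  rw [← rate_smul_jumpKernel k x, Measure.smul_apply, smul_eq_mul, mul_eq_zero] at hx
  exact hx.resolve_left hx0.ne'

/-- The states of rate zero form a `μ`-null set, which the chain almost surely never enters; thus
all jump times are finite. -/
theorem ae_chainLaw_rate_pos {k : Kernel Ω Ω} [hk : FiniteRates k] {μ : Measure Ω} [SFinite μ]
    (hrev : (conductance μ k).map Prod.swap = conductance μ k)
    (hpos : ∀ᵐ x ∂μ, 0 < k x univ) :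
    ∀ᵐ x ∂μ, ∀ᵐ y ∂(chainLaw (jumpKernel k) x), ∀ i, 0 < k (y i) univ := by
  have hm : MeasurableSet {x | k x univ = 0} :=
    k.measurable_coe MeasurableSet.univ (measurableSet_singleton 0)
  have h0 : μ {x | k x univ = 0} = 0 := by simpa [ae_iff, pos_iff_ne_zero] using hpos
  have h := hitProb_univ_eq_zero (jumpKernel k) (μ := μ) (A := {x | k x univ = 0})
    (S := {x | k x univ = 0}ᶜ) (fun N hN => (ae_jumpKernel_eq_zero hrev hpos hN).2)
    ((ae_jumpKernel_eq_zero hrev hpos h0).2.mono fun x hx _ => by rwa [compl_compl])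
    (fun x hx => hx)
  filter_upwards [h, hpos] with x hx hx0
  have := chainLaw_exists_mem_le (jumpKernel k) hm x
  rw [hx hx0.ne', nonpos_iff_eq_zero] at this
  simpa [ae_iff] using this

end JumpProcess

/-! ### The harmonic function and the capacity in terms of the chain. -/

section Harmonic

variable (k : Kernel Ω Ω)

/-- The probability that the jump chain reaches `A`, and does not visit `B` before. -/
noncomputable def chainHarmonic (A B : Set Ω) : Ω → ℝ≥0∞ := hitProb (jumpKernel k) (A ∪ B)ᶜ A

variable {A B : Set Ω}

theorem measurable_chainHarmonic (hA : MeasurableSet A) (hB : MeasurableSet B) :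
    Measurable (chainHarmonic k A B) :=
  measurable_hitProb _ (hA.union hB).compl hA

theorem chainHarmonic_le_one [FiniteRates k] (hA : MeasurableSet A) (hB : MeasurableSet B) (x : Ω) :
    chainHarmonic k A B x ≤ 1 :=
  hitProb_le_one _ (hA.union hB).compl hA
    (disjoint_compl_left.mono_right subset_union_left) x

theorem chainHarmonic_of_mem_left (hA : MeasurableSet A) (hB : MeasurableSet B) {x : Ω}
    (hx : x ∈ A) : chainHarmonic k A B x = 1 := by
  rw [chainHarmonic, hitProb_eq _ (hA.union hB).compl hA]
  simp [killedOperator, hx]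

theorem chainHarmonic_of_mem_right (hA : MeasurableSet A) (hB : MeasurableSet B)
    (hAB : Disjoint A B) {x : Ω} (hx : x ∈ B) : chainHarmonic k A B x = 0 := by
  rw [chainHarmonic, hitProb_eq _ (hA.union hB).compl hA]
  simp [killedOperator, hx, hAB.notMem_of_mem_right hx]

theorem lintegral_chainHarmonic [FiniteRates k] (hA : MeasurableSet A) (hB : MeasurableSet B) {x : Ω}
    (hx : x ∉ A ∪ B) :
    ∫⁻ y, chainHarmonic k A B y ∂(k x) = chainHarmonic k A B x * k x univ := by
  have hxA : x ∉ A := fun h => hx (Or.inl h)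
  have h : chainHarmonic k A B x = ∫⁻ y, chainHarmonic k A B y ∂(jumpKernel k x) := by
    conv_lhs => rw [chainHarmonic, hitProb_eq _ (hA.union hB).compl hA]
    rw [killedOperator, indicator_of_mem (mem_compl hx), indicator_of_notMem hxA, zero_add]
    rfl
  conv_lhs => rw [← rate_smul_jumpKernel k x]
  rw [lintegral_smul_measure, smul_eq_mul, mul_comm, ← h]

/-- For almost every starting point all rates and clocks are positive almost surely, and then the
two hitting events coincide. -/
theorem harmonic_ae_eq [MeasurableSingletonClass Ω] {k : Kernel Ω Ω} [FiniteRates k]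
    {μ : Measure Ω} [SFinite μ]
    (hrev : (conductance μ k).map Prod.swap = conductance μ k)
    (hpos : ∀ᵐ x ∂μ, 0 < k x univ)
    (hA : MeasurableSet A) (hB : MeasurableSet B) (hAB : Disjoint A B) :
    ∀ᵐ x ∂μ, harmonic k A B x = (chainHarmonic k A B x).toReal := by
  have : IsProbabilityMeasure (expMeasure 1) := isProbabilityMeasure_expMeasure one_pos
  filter_upwards [ae_chainLaw_rate_pos hrev hpos] with x hx
  unfold harmonic
  split_ifs with hxA hxB
  · simp [chainHarmonic_of_mem_left k hA hB hxA]
  · simp [chainHarmonic_of_mem_right k hA hB hAB hxB]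
  have h0 : ∀ᵐ y ∂(chainLaw (jumpKernel k) x), y 0 = x := by
    refine ae_of_ae_map (f := fun y : ℕ → Ω => y 0) (p := fun z => z = x)
      (measurable_pi_apply 0).aemeasurable ?_
    rw [map_eval_zero_chainLaw]
    exact (ae_dirac_iff (measurableSet_singleton x)).2 rfl
  have hD := (hA.union hB).compl
  rw [Measure.real, chainHarmonic, ← chainLaw_hitEvent (jumpKernel k) hD hA
    (disjoint_compl_left.mono_right subset_union_left),
    ← jumpLaw_fst_preimage]
  congr 1
  refine measure_congr ?_
  have h1 : ∀ᵐ ω ∂(jumpLaw k x), (∀ i, 0 < k (ω.1 i) univ) ∧ ω.1 0 = x :=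
    Measure.quasiMeasurePreserving_fst.ae (hx.and h0)
  have h2 : ∀ᵐ ω ∂(jumpLaw k x), ∀ i, 0 < ω.2 i :=
    Measure.quasiMeasurePreserving_snd.ae ae_clocks_pos
  filter_upwards [h1, h2] with ω h3 h4
  refine propext (hittingTime_lt_iff k hAB (strictMono_jumpTime k h3.1 h4) ?_)
  rw [h3.2]
  exact fun h => h.elim hxA hxB

theorem ae_hitProb_ne_zero {k : Kernel Ω Ω} [FiniteRates k] {μ : Measure Ω}
    (hirr : IsIrreducible k μ) {C : Set Ω} (hC : MeasurableSet C) (hμC : μ C ≠ 0) :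
    ∀ᵐ x ∂μ, hitProb (jumpKernel k) univ C x ≠ 0 := by
  filter_upwards [hirr C hC hμC] with x hx h
  refine hx (measure_mono_null (t := Prod.fst ⁻¹' {y : ℕ → Ω | ∃ n, y n ∈ C})
    (fun ω hω => exists_mem_of_hittingTime_lt_top k hω) ?_)
  rw [jumpLaw_fst_preimage, ← nonpos_iff_eq_zero, ← h]
  exact chainLaw_exists_mem_le _ hC x

/-- The capacity, in terms of the jump chain. -/
theorem capacity_eq_toReal [MeasurableSingletonClass Ω] {k : Kernel Ω Ω} [hk : FiniteRates k]
    {μ : Measure Ω} [SFinite μ]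
    (hrev : (conductance μ k).map Prod.swap = conductance μ k)
    (hpos : ∀ᵐ x ∂μ, 0 < k x univ)
    (hA : MeasurableSet A) (hB : MeasurableSet B) (hAB : Disjoint A B) :
    capacity μ k A B =
      (∫⁻ z in A ×ˢ univ, (1 - chainHarmonic k A B z.2) ∂(conductance μ k)).toReal := by
  have hm := measurable_chainHarmonic k hA hB
  have h1 := harmonic_ae_eq hrev hpos hA hB hAB
  have h2 := (ae_jumpKernel_eq_zero hrev hpos h1).1
  have hmeas : Measurable fun x => ∫⁻ y, (1 - chainHarmonic k A B y) ∂(k x) :=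
    (measurable_const.sub hm).lintegral_kernel
  rw [conductance, Measure.setLIntegral_compProd (by fun_prop) hA MeasurableSet.univ]
  simp only [Measure.restrict_univ]
  rw [← integral_toReal hmeas.aemeasurable]
  · rw [capacity]
    refine setIntegral_congr_ae hA ?_
    filter_upwards [h2] with x hx hxA
    have hx' : ∀ᵐ y ∂(k x), harmonic k A B y = (chainHarmonic k A B y).toReal := hx
    have : IsFiniteMeasure (k x) := ⟨hk.lt_top x⟩
    rw [generator, ← integral_neg, ← integral_toReal (by fun_prop)]
    · refine integral_congr_ae ?_
      filter_upwards [hx'] with y hy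
      rw [hy, ENNReal.toReal_sub_of_le (chainHarmonic_le_one k hA hB y) ENNReal.one_ne_top]
      simp [harmonic, hxA]
    · exact Filter.Eventually.of_forall fun y => tsub_le_self.trans_lt ENNReal.one_lt_top
  · refine Filter.Eventually.of_forall fun x => ?_
    refine (lintegral_mono fun y => tsub_le_self).trans_lt ?_
    simpa using hk.lt_top x

end Harmonic
-- Dirichlet energy and Kirchhoff's law for a potential.
section Energy

theorem ENNReal_sq_tsub_add (a b : ℝ≥0∞) :
    (a - b) ^ 2 + (b - a) ^ 2 + 2 * (a * b) = a * a + b * b := by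
  rcases le_total a b with h | h <;> obtain ⟨d, rfl⟩ := exists_add_of_le h
  · by_cases ha : a = ∞
    · simp [ha]
    · rw [tsub_eq_zero_of_le h, ENNReal.add_sub_cancel_left ha]; ring
  · by_cases hb : b = ∞
    · simp [hb]
    · rw [tsub_eq_zero_of_le h, ENNReal.add_sub_cancel_left hb]; ring

/-- `H` is an equilibrium potential for the symmetric conductance `K`: it takes the values `1` on
`A` and `0` on `B`, and is harmonic elsewhere. -/
structure IsPotential (K : Measure (Ω × Ω)) (A B : Set Ω) (H : Ω → ℝ≥0∞) : Prop where
  symm : K.map Prod.swap = K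
  measurable : Measurable H
  le_one : ∀ x, H x ≤ 1
  eq_one : ∀ x ∈ A, H x = 1
  eq_zero : ∀ x ∈ B, H x = 0
  -- The equation `L H = 0` off `A ∪ B`, tested against `f` and written without subtraction.
  balance : ∀ f : Ω → ℝ≥0∞, Measurable f → (∀ x ∈ A ∪ B, f x = 0) →
    ∫⁻ z, f z.1 * H z.2 ∂K = ∫⁻ z, f z.1 * H z.1 ∂K

/-- The total flow out of `A` of the potential `H`. -/
noncomputable def outFlow (K : Measure (Ω × Ω)) (A : Set Ω) (H : Ω → ℝ≥0∞) : ℝ≥0∞ :=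
  ∫⁻ z, A.indicator 1 z.1 * (1 - H z.2) ∂K

theorem indicator_one_le_one {α : Type*} (s : Set α) (x : α) : s.indicator (1 : α → ℝ≥0∞) x ≤ 1 :=
  indicator_apply_le' (fun _ => le_rfl) fun _ => zero_le

theorem lintegral_lt_top_of_le_one {α : Type*} [MeasurableSpace α] {m : Measure α}
    [IsFiniteMeasure m] {f : α → ℝ≥0∞} (hf : ∀ z, f z ≤ 1) : ∫⁻ z, f z ∂m < ∞ :=
  (lintegral_mono hf).trans_lt (by simp [measure_lt_top])

theorem outFlow_lt_top (K : Measure (Ω × Ω)) [IsFiniteMeasure K] (A : Set Ω) (H : Ω → ℝ≥0∞) :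
    outFlow K A H < ∞ :=
  lintegral_lt_top_of_le_one fun _ => mul_le_one' (indicator_one_le_one _ _) tsub_le_self

namespace IsPotential

variable {K : Measure (Ω × Ω)} {A B : Set Ω} {H : Ω → ℝ≥0∞}

theorem lintegral_swap (h : IsPotential K A B H) {f : Ω × Ω → ℝ≥0∞} (hf : Measurable f) :
    ∫⁻ z, f z.swap ∂K = ∫⁻ z, f z ∂K := by
  conv_rhs => rw [← h.symm]
  rw [lintegral_map hf measurable_swap]

theorem lintegral_indicator_flow (h : IsPotential K A B H) :
    ∫⁻ z, A.indicator 1 z.1 * (H z.1 - H z.2) ∂K = outFlow K A H := by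
  refine lintegral_congr fun z => ?_
  by_cases hz : z.1 ∈ A
  · rw [h.eq_one _ hz]
  · simp [hz]

variable [IsFiniteMeasure K]

/-- Discrete Green formula. Writing `H = 1_A + f` with `f` supported off `A ∪ B`, `balance` gives `∫
H(x)² = outFlow + ∫ H(x) H(y)`. By symmetry the truncated squares carry half of `∫ (H(x) - H(y))²`,
and the finite cross term cancels. -/
theorem lintegral_sq (h : IsPotential K A B H) (hA : MeasurableSet A) (hB : MeasurableSet B) : ∫⁻ z, (H z.1 - H z.2) ^ 2 ∂K = outFlow K A H := by
  have hm := h.measurable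
  have hmA : Measurable (A.indicator (1 : Ω → ℝ≥0∞)) := measurable_one.indicator hA
  set f : Ω → ℝ≥0∞ := (A ∪ B)ᶜ.indicator H with hf
  have hfm : Measurable f := hm.indicator (hA.union hB).compl
  have hH : ∀ x, H x = A.indicator 1 x + f x := fun x => by
    by_cases hxA : x ∈ A
    · simp [hf, hxA, h.eq_one x hxA]
    · by_cases hxB : x ∈ B
      · simp [hf, hxA, hxB, h.eq_zero x hxB]
      · simp [hf, hxA, hxB]
  have hbal := h.balance f hfm fun x hx => by simp only [hf]; rw [indicator_of_notMem (not_not_intro hx)]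
  have hle : ∀ x y, H x * H y ≤ 1 := fun x y => mul_le_one' (h.le_one x) (h.le_one y)
  have hYfin : ∫⁻ z, H z.1 * H z.2 ∂K ≠ ∞ := (lintegral_lt_top_of_le_one fun z => hle _ _).ne
  have hZ : ∫⁻ z, H z.1 * H z.1 ∂K = outFlow K A H + ∫⁻ z, H z.1 * H z.2 ∂K := by
    have e1 : ∀ z : Ω × Ω, H z.1 * H z.1 =
        A.indicator 1 z.1 * (1 - H z.2) + A.indicator 1 z.1 * H z.2 + f z.1 * H z.1 := fun z => by
      rw [← mul_add, tsub_add_cancel_of_le (h.le_one _), mul_one]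
      nth_rw 1 [hH z.1]
      rw [add_mul]
      congr 1
      by_cases hz : z.1 ∈ A <;> simp [hz, h.eq_one]
    have e2 : ∀ z : Ω × Ω, H z.1 * H z.2 = A.indicator 1 z.1 * H z.2 + f z.1 * H z.2 := fun z => by
      rw [← add_mul, ← hH]
    simp_rw [e2]
    rw [lintegral_congr e1, lintegral_add_left (by fun_prop), lintegral_add_left (by fun_prop),
      lintegral_add_left (by fun_prop), hbal, outFlow, add_assoc]
  have hX : 2 * (∫⁻ z, (H z.1 - H z.2) ^ 2 ∂K + ∫⁻ z, H z.1 * H z.2 ∂K) =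
      2 * ∫⁻ z, H z.1 * H z.1 ∂K := by
    have e := lintegral_congr (μ := K) fun z => ENNReal_sq_tsub_add (H z.1) (H z.2)
    rw [lintegral_add_left (by fun_prop), lintegral_add_left (by fun_prop),
      lintegral_add_left (by fun_prop), lintegral_const_mul _ (by fun_prop)] at e
    have s1 := h.lintegral_swap (f := fun z => (H z.1 - H z.2) ^ 2) (by fun_prop)
    have s2 := h.lintegral_swap (f := fun z => H z.1 * H z.1) (by fun_prop)
    simp only [Prod.fst_swap, Prod.snd_swap] at s1 s2
    rw [s1, s2] at e
    rw [mul_add, two_mul, e, two_mul]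
  rw [ENNReal.mul_right_inj two_ne_zero ENNReal.ofNat_ne_top, hZ] at hX
  exact (ENNReal.add_left_inj hYfin).1 hX

/-- Kirchhoff's law: outside `A ∪ B` the flow into each set equals the flow out of it. -/
theorem lintegral_flow_symm (h : IsPotential K A B H) {g : Ω → ℝ≥0∞} (hg : Measurable g)
    (hg1 : ∀ x, g x ≤ 1) (hg0 : ∀ x ∈ A ∪ B, g x = 0) :
    ∫⁻ z, g z.1 * (H z.1 - H z.2) ∂K = ∫⁻ z, g z.2 * (H z.1 - H z.2) ∂K := by
  have hm := h.measurable
  have hfin : ∫⁻ z, g z.1 * H z.1 ∂K ≠ ∞ :=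
    (lintegral_lt_top_of_le_one fun z => mul_le_one' (hg1 _) (h.le_one _)).ne
  have s := h.lintegral_swap (f := fun z => g z.2 * (H z.1 - H z.2)) (by fun_prop)
  simp only [Prod.fst_swap, Prod.snd_swap] at s
  rw [← s, ← ENNReal.add_left_inj hfin]
  nth_rw 1 [← h.balance g hg hg0]
  rw [← lintegral_add_left (by fun_prop), ← lintegral_add_left (by fun_prop)]
  -- After adding `∫ g(x) H(x)`, rewritten on the left through `balance`, both integrands are `g(x)
  -- max (H(x), H(y))`.
  refine lintegral_congr fun z => ?_
  rw [← mul_add, ← mul_add, tsub_add_eq_max, tsub_add_eq_max, max_comm]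

/-- Nothing flows out of `B`, where `H = 0`, and nothing into `A`, where `H = 1`; elsewhere
Kirchhoff's law applies. -/
theorem lintegral_flow_balance (h : IsPotential K A B H) (hA : MeasurableSet A)
    (hB : MeasurableSet B) {g : Ω → ℝ≥0∞} (hg : Measurable g)
    (hg1 : ∀ x, g x ≤ 1) :
    ∫⁻ z, g z.1 * (H z.1 - H z.2) ∂K =
      ∫⁻ z, A.indicator g z.1 * (H z.1 - H z.2) ∂K +
        ∫⁻ z, Bᶜ.indicator g z.2 * (H z.1 - H z.2) ∂K := by
  have hm := h.measurable
  have hgA : Measurable (A.indicator g) := hg.indicator hA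
  have hgD : Measurable ((A ∪ B)ᶜ.indicator g) := hg.indicator (hA.union hB).compl
  have e1 : ∀ z : Ω × Ω, g z.1 * (H z.1 - H z.2) =
      A.indicator g z.1 * (H z.1 - H z.2) + (A ∪ B)ᶜ.indicator g z.1 * (H z.1 - H z.2) := fun z => by
    by_cases hxA : z.1 ∈ A
    · simp [hxA]
    · by_cases hxB : z.1 ∈ B
      · simp [h.eq_zero _ hxB]
      · simp [hxA, hxB]
  have e2 : ∀ z : Ω × Ω, Bᶜ.indicator g z.2 * (H z.1 - H z.2) =
      (A ∪ B)ᶜ.indicator g z.2 * (H z.1 - H z.2) := fun z => by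
    by_cases hxA : z.2 ∈ A
    · rw [h.eq_one _ hxA, tsub_eq_zero_of_le (h.le_one _), mul_zero, mul_zero]
    · by_cases hxB : z.2 ∈ B
      · simp [hxB]
      · simp [hxA, hxB]
  rw [lintegral_congr e1, lintegral_congr e2, lintegral_add_left (by fun_prop),
    h.lintegral_flow_symm hgD (fun x => (indicator_le_self _ g x).trans (hg1 x)) fun x hx => by
      rw [indicator_of_notMem (not_not_intro hx)]]

/-- The flow out of `A` equals the flow into `B`. -/
theorem outFlow_eq_inFlow (h : IsPotential K A B H) (hA : MeasurableSet A)
    (hB : MeasurableSet B) :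
    outFlow K A H = ∫⁻ z, B.indicator 1 z.2 * (H z.1 - H z.2) ∂K := by
  have hm := h.measurable
  have hB' : Measurable (B.indicator (1 : Ω → ℝ≥0∞)) := measurable_one.indicator hB
  have e := h.lintegral_flow_balance hA hB (g := 1) measurable_one fun _ => le_rfl
  rw [h.lintegral_indicator_flow] at e
  have hfin : ∫⁻ z, Bᶜ.indicator 1 z.2 * (H z.1 - H z.2) ∂K ≠ ∞ :=
    (lintegral_lt_top_of_le_one fun z => mul_le_one' (indicator_one_le_one _ _)
      (tsub_le_self.trans (h.le_one _))).ne
  rw [← ENNReal.add_left_inj hfin, ← e, ← lintegral_add_left (by fun_prop)]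
  refine lintegral_congr fun z => ?_
  by_cases hz : z.2 ∈ B <;> simp [hz]

/-- If there is no flow, then the potential is constant along almost every edge. -/
theorem ae_eq_of_outFlow_eq_zero (h : IsPotential K A B H) (hA : MeasurableSet A)
    (hB : MeasurableSet B) (h0 : outFlow K A H = 0) :
    ∀ᵐ z ∂K, H z.1 = H z.2 := by
  have hm := h.measurable
  have h1 : ∀ᵐ z ∂K, H z.1 ≤ H z.2 := by
    rw [← h.lintegral_sq hA hB, lintegral_eq_zero_iff (by fun_prop)] at h0
    filter_upwards [h0] with z hz
    have := pow_eq_zero_iff (two_ne_zero) |>.1 hz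
    exact tsub_eq_zero_iff_le.1 this
  have h2 : ∀ᵐ z ∂K, H z.2 ≤ H z.1 := by
    rw [← h.symm] at h1
    exact ae_of_ae_map measurable_swap.aemeasurable h1
  filter_upwards [h1, h2] with z h1 h2 using le_antisymm h1 h2

end IsPotential

theorem isPotential_chainHarmonic {k : Kernel Ω Ω} [FiniteRates k] {μ : Measure Ω} [SFinite μ]
    {A B : Set Ω} (hrev : (conductance μ k).map Prod.swap = conductance μ k)
    (hA : MeasurableSet A) (hB : MeasurableSet B) (hAB : Disjoint A B) :
    IsPotential (conductance μ k) A B (chainHarmonic k A B) where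
  symm := hrev
  measurable := measurable_chainHarmonic k hA hB
  le_one := chainHarmonic_le_one k hA hB
  eq_one _ := chainHarmonic_of_mem_left k hA hB
  eq_zero _ := chainHarmonic_of_mem_right k hA hB hAB
  balance f hf h0 := by
    have hm := measurable_chainHarmonic k hA hB
    rw [conductance, Measure.lintegral_compProd (by fun_prop),
      Measure.lintegral_compProd (by fun_prop)]
    refine lintegral_congr fun x => ?_
    simp only
    rw [lintegral_const_mul _ hm, lintegral_const]
    by_cases hx : x ∈ A ∪ B
    · simp [h0 x hx]
    · rw [lintegral_chainHarmonic k hA hB hx, mul_assoc]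

end Energy
-- Paths, edge measures and the upper bound.
section Paths

theorem measurable_finPath_iff {β : Type*} [MeasurableSpace β] {f : FinPath Ω → β} :
    Measurable f ↔ ∀ n, Measurable fun g : Fin (n + 1) → Ω => f ⟨n, g⟩ := by
  constructor
  · intro hf n s hs
    exact MeasurableSpace.measurableSet_iInf.1 (hf hs) n
  · intro hf s hs
    exact MeasurableSpace.measurableSet_iInf.2 fun n => hf n hs

theorem measurable_length : Measurable (Sigma.fst : FinPath Ω → ℕ) :=
  measurable_finPath_iff.2 fun _ => measurable_const

theorem measurable_sum_edge {f : Ω × Ω → ℝ≥0∞} (hf : Measurable f) :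
    Measurable fun γ : FinPath Ω => ∑ j : Fin γ.1, f (edge γ j) := by
  refine measurable_finPath_iff.2 fun n => ?_
  change Measurable fun g : Fin (n + 1) → Ω => ∑ j : Fin n, f (g j.castSucc, g j.succ)
  fun_prop

theorem measurableSet_pathsBetween {A B : Set Ω} (hA : MeasurableSet A) (hB : MeasurableSet B) :
    MeasurableSet (pathsBetween A B) := by
  refine MeasurableSpace.measurableSet_iInf.2 fun n => ?_
  change MeasurableSet {g : Fin (n + 1) → Ω | g 0 ∈ A ∧ g (Fin.last n) ∈ B ∧
    ∀ i : Fin (n + 1), i ≠ 0 → i ≠ Fin.last n → g i ∉ B}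
  refine (measurable_pi_apply 0 hA).inter ((measurable_pi_apply _ hB).inter ?_)
  have : {g : Fin (n + 1) → Ω | ∀ i : Fin (n + 1), i ≠ 0 → i ≠ Fin.last n → g i ∉ B} =
      ⋂ i : Fin (n + 1), {g | i ≠ 0 → i ≠ Fin.last n → g i ∉ B} := by ext; simp
  change MeasurableSet {g : Fin (n + 1) → Ω | ∀ i : Fin (n + 1), i ≠ 0 → i ≠ Fin.last n → g i ∉ B}
  rw [this]
  refine MeasurableSet.iInter fun i => ?_
  by_cases h1 : i = 0
  · simp [h1]
  by_cases h2 : i = Fin.last n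
  · simp [h2]
  simp only [ne_eq, h1, not_false_eq_true, h2, forall_const]
  exact measurable_pi_apply (X := fun _ : Fin (n + 1) => Ω) i hB.compl

/-- The expected path length may be infinite, so `edgeMeasure P` need not be finite. Splitting by
length gives s-finiteness, enough for a Radon-Nikodym density with respect to a finite `K`. -/
instance sFinite_edgeMeasure (P : Measure (FinPath Ω)) [SFinite P] : SFinite (edgeMeasure P) := by
  classical
  let κ : Kernel (FinPath Ω) (Ω × Ω) := ⟨edgeCount, measurable_edgeCount⟩
  have hs : ∀ n : ℕ, MeasurableSet {γ : FinPath Ω | γ.1 = n} := fun n =>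
    measurable_length (measurableSet_singleton n)
  have hκ : IsSFiniteKernel κ := by
    refine ⟨⟨fun n => Kernel.piecewise (hs n) κ 0, fun n => ⟨⟨n, by simp, fun γ => ?_⟩⟩, ?_⟩⟩
    · rw [Kernel.piecewise_apply]
      split_ifs with hγ
      · change edgeCount γ univ ≤ n
        have : γ.1 = n := hγ
        simp [edgeCount, this]
      · simp
    · ext γ t ht
      rw [Kernel.sum_apply' _ _ ht, tsum_eq_single γ.1]
      · simp [Kernel.piecewise_apply]
      · intro n hn
        simp [Kernel.piecewise_apply, hn.symm]
  exact inferInstanceAs (SFinite (κ ∘ₘ P))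

/-- The expected number of bad edges is zero, so almost every path has none. -/
theorem ae_forall_edge {P : Measure (FinPath Ω)} {q : Ω × Ω → Prop}
    (h : ∀ᵐ z ∂(edgeMeasure P), q z) : ∀ᵐ γ ∂P, ∀ j, q (edge γ j) := by
  set N := toMeasurable (edgeMeasure P) {z | ¬ q z} with hN
  have hNm : MeasurableSet N := measurableSet_toMeasurable _ _
  have h0 : edgeMeasure P N = 0 := by rw [hN, measure_toMeasurable]; exact h
  have hm : Measurable (N.indicator (1 : Ω × Ω → ℝ≥0∞)) := measurable_one.indicator hNm
  rw [← lintegral_indicator_one hNm, lintegral_edgeMeasure P hm,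
    lintegral_eq_zero_iff (measurable_sum_edge hm)] at h0
  filter_upwards [h0] with γ hγ j
  by_contra hq
  have h1 : N.indicator (1 : Ω × Ω → ℝ≥0∞) (edge γ j) = 0 :=
    Finset.sum_eq_zero_iff.1 hγ j (Finset.mem_univ j)
  rw [indicator_of_mem (subset_toMeasurable _ _ hq)] at h1
  exact one_ne_zero h1

/-- Sedrakyan's inequality, with values in `[0, ∞]`. -/
theorem ENNReal_inv_sum_le {ι : Type*} (s : Finset ι) (a φ : ι → ℝ≥0∞) (h : 1 ≤ ∑ i ∈ s, a i) :
    (∑ i ∈ s, φ i)⁻¹ ≤ ∑ i ∈ s, a i ^ 2 / φ i := by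
  by_cases htop : ∃ i ∈ s, φ i = ∞
  · obtain ⟨i, hi, h'⟩ := htop
    rw [ENNReal.sum_eq_top.2 ⟨i, hi, h'⟩, ENNReal.inv_top]
    exact zero_le
  by_cases hzero : ∃ i ∈ s, φ i = 0 ∧ a i ≠ 0
  · obtain ⟨i, hi, h0, ha⟩ := hzero
    rw [ENNReal.sum_eq_top (f := fun i => a i ^ 2 / φ i) |>.2 ⟨i, hi, ?_⟩]
    · exact le_top
    · rw [h0, ENNReal.div_zero (pow_ne_zero 2 ha)]
  push Not at htop hzero
  -- Cauchy-Schwarz for `a = (a² / φ)^(1/2) φ^(1/2)`. The degenerate cases being removed, this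
  -- factorization also holds where `φ = 0`, because `a = 0` there.
  have hCS := ENNReal.inner_le_Lp_mul_Lq s (fun i => (a i ^ 2 / φ i) ^ (1 / 2 : ℝ))
    (fun i => φ i ^ (1 / 2 : ℝ)) (p := 2) (q := 2) (by norm_num [Real.holderConjugate_iff])
  have e0 : ∀ x : ℝ≥0∞, (x ^ (1 / 2 : ℝ)) ^ (2 : ℝ) = x := fun x => by
    rw [← ENNReal.rpow_mul]; norm_num
  have e1 : ∑ i ∈ s, (a i ^ 2 / φ i) ^ (1 / 2 : ℝ) * φ i ^ (1 / 2 : ℝ) = ∑ i ∈ s, a i := by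
    refine Finset.sum_congr rfl fun i hi => ?_
    rw [← ENNReal.mul_rpow_of_nonneg _ _ (by norm_num)]
    have : a i ^ 2 / φ i * φ i = a i ^ 2 := by
      by_cases h0 : φ i = 0
      · simp [h0, hzero i hi h0]
      · exact ENNReal.div_mul_cancel h0 (htop i hi)
    rw [this, ← ENNReal.rpow_natCast, ← ENNReal.rpow_mul]
    norm_num
  simp only [e0] at hCS
  rw [e1, ← ENNReal.mul_rpow_of_nonneg _ _ (by norm_num)] at hCS
  have h1 := ENNReal.rpow_le_rpow (h.trans hCS) (zero_le_two (α := ℝ))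
  rw [e0, ENNReal.one_rpow] at h1
  refine ENNReal.inv_le_iff_le_mul ?_ ?_ |>.2 (by rwa [mul_comm] at h1)
  · intro h2 h3
    simp [h3] at h1
  · intro h2
    exact absurd h2 (ENNReal.sum_ne_top.2 htop)

theorem le_add_sum_tsub {X : Type*} (H : X → ℝ≥0∞) (γ : FinPath X) :
    H (γ.2 0) ≤ H (γ.2 (Fin.last γ.1)) + ∑ j : Fin γ.1, (H (edge γ j).1 - H (edge γ j).2) := by
  obtain ⟨n, g⟩ := γ
  change H (g 0) ≤ H (g (Fin.last n)) + ∑ j : Fin n, (H (g j.castSucc) - H (g j.succ))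
  induction n with
  | zero => simp
  | succ n ih =>
    rw [Fin.sum_univ_castSucc]
    refine (ih fun i => g i.castSucc).trans ?_
    simp only [Fin.succ_castSucc, Fin.succ_last]
    rw [← add_assoc, add_right_comm]
    gcongr
    exact le_add_tsub

theorem tsub_sum_eq_one {X : Type*} {H : X → ℝ≥0∞} {γ : FinPath X} (h1 : H (γ.2 0) = 1)
    (h0 : H (γ.2 (Fin.last γ.1)) = 0) (hdec : ∀ j, H (edge γ j).2 ≤ H (edge γ j).1) :
    ∑ j : Fin γ.1, (H (edge γ j).1 - H (edge γ j).2) = 1 := by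
  have key : ∀ (n : ℕ) (g : Fin (n + 1) → X), (∀ j : Fin n, H (g j.succ) ≤ H (g j.castSucc)) →
      H (g (Fin.last n)) + ∑ j : Fin n, (H (g j.castSucc) - H (g j.succ)) = H (g 0) := by
    intro n
    induction n with
    | zero => intro g _; simp
    | succ n ih =>
      intro g hg
      rw [Fin.sum_univ_castSucc]
      have := ih (fun i => g i.castSucc) fun j => hg j.castSucc
      simp only [Fin.castSucc_zero] at this
      rw [← this]
      simp only [Fin.succ_castSucc, ← Fin.succ_last]
      rw [← add_assoc, add_right_comm, add_tsub_cancel_of_le (hg (Fin.last n))]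
  have := key γ.1 γ.2 hdec
  rw [h0, h1, zero_add] at this
  exact this

theorem injective_of_strictAnti_edges {X : Type*} {H : X → ℝ≥0∞} {γ : FinPath X}
    (hdec : ∀ j, H (edge γ j).2 < H (edge γ j).1) : γ ∈ selfAvoiding := by
  have : StrictAnti fun i => H (γ.2 i) := Fin.strictAnti_iff_succ_lt.2 hdec
  exact fun i j hij => this.injective (congrArg H hij)

/-- The upper bound in the Berman-Konsowa principle. -/
theorem pathValue_le {K : Measure (Ω × Ω)} [IsFiniteMeasure K] {A B : Set Ω}
    {H : Ω → ℝ≥0∞} (hH : Measurable H) (h1 : ∀ x ∈ A, H x = 1) (h0 : ∀ x ∈ B, H x = 0)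
    {P : Measure (FinPath Ω)} (hP : P ∈ admissible K A B) :
    pathValue K P ≤ ∫⁻ z, (H z.1 - H z.2) ^ 2 ∂K := by
  obtain ⟨hprob, hpath, hac⟩ := hP
  set φ := (edgeMeasure P).rnDeriv K with hφ
  have hφm : Measurable φ := Measure.measurable_rnDeriv _ _
  have hd : K.withDensity φ = edgeMeasure P := Measure.withDensity_rnDeriv_eq _ _ hac
  calc pathValue K P
      ≤ ∫⁻ γ, ∑ j : Fin γ.1, (H (edge γ j).1 - H (edge γ j).2) ^ 2 / φ (edge γ j) ∂P := by
        refine lintegral_mono_ae ?_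
        filter_upwards [hpath] with γ hγ
        refine ENNReal_inv_sum_le _ (fun j => H (edge γ j).1 - H (edge γ j).2) _ ?_
        have := le_add_sum_tsub H γ
        rwa [h1 _ hγ.1, h0 _ hγ.2.1, zero_add] at this
    _ = ∫⁻ z, (H z.1 - H z.2) ^ 2 / φ z ∂(edgeMeasure P) :=
        (lintegral_edgeMeasure P (f := fun z => (H z.1 - H z.2) ^ 2 / φ z) (by fun_prop)).symm
    _ = ∫⁻ z, φ z * ((H z.1 - H z.2) ^ 2 / φ z) ∂K := by
        rw [← hd, lintegral_withDensity_eq_lintegral_mul _ hφm (by fun_prop)]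
        rfl
    -- Only an inequality: the left side misses the edges where `φ = 0`.
    _ ≤ ∫⁻ z, (H z.1 - H z.2) ^ 2 ∂K := lintegral_mono fun z => ENNReal.mul_div_le

/-- There is no admissible path measure if `K` does not charge the edges from `A` or to `B`. -/
theorem admissible_eq_empty {K : Measure (Ω × Ω)} {A B : Set Ω} (hAB : Disjoint A B)
    (h : K (A ×ˢ univ) = 0 ∨ K (univ ×ˢ B) = 0) : admissible K A B = ∅ := by
  refine eq_empty_of_forall_notMem fun P ⟨hprob, hpath, hac⟩ => ?_
  have h2 : ∀ᵐ γ ∂P, (∀ j : Fin γ.1, (edge γ j).1 ∉ A) ∨ ∀ j : Fin γ.1, (edge γ j).2 ∉ B := by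
    rcases h with h | h
    · have : ∀ᵐ z ∂(edgeMeasure P), z.1 ∉ A := by simpa [ae_iff, prod_univ] using! hac h
      filter_upwards [ae_forall_edge this] with γ hγ using Or.inl hγ
    · have : ∀ᵐ z ∂(edgeMeasure P), z.2 ∉ B := by simpa [ae_iff, univ_prod] using! hac h
      filter_upwards [ae_forall_edge this] with γ hγ using Or.inr hγ
  have h3 : ∀ᵐ γ ∂P, False := by
    filter_upwards [h2, hpath] with γ h4 h5
    obtain ⟨n, g⟩ := γ
    obtain ⟨hgA, hgB, -⟩ := h5
    cases n with
    -- A path without edges would have its only point in `A ∩ B`.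
    | zero => exact hAB.le_bot ⟨hgA, hgB⟩
    | succ n =>
      rcases h4 with h4 | h4
      · exact h4 (0 : Fin (n + 1)) hgA
      · exact h4 (Fin.last n) hgB
  exact IsProbabilityMeasure.ne_zero P (by simpa using h3)

end Paths
-- The Markov chain of a flow, stopped in `B`.
section FlowChain

/-- The trajectories that avoid `B` from time `1` to time `n`. -/
def avoidUpTo {X : Type*} (B : Set X) (n : ℕ) : Set (ℕ → X) := {y | ∀ i, 1 ≤ i → i ≤ n → y i ∉ B}

theorem measurableSet_avoidUpTo {B : Set Ω} (hB : MeasurableSet B) (n : ℕ) :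
    MeasurableSet (avoidUpTo B n) := by
  have : avoidUpTo B n = ⋂ i ∈ Finset.Icc 1 n, (fun y : ℕ → Ω => y i) ⁻¹' Bᶜ := by
    ext y; simp [avoidUpTo]
  rw [this]
  exact Finset.measurableSet_biInter _ fun i _ => measurable_pi_apply i hB.compl

theorem avoidUpTo_zero {X : Type*} (B : Set X) : avoidUpTo B 0 = univ :=
  eq_univ_of_forall fun y i h1 h0 => by omega

theorem mem_avoidUpTo_succ {X : Type*} {B : Set X} {n : ℕ} {y : ℕ → X} :
    y ∈ avoidUpTo B (n + 1) ↔ y ∈ avoidUpTo B n ∧ y (n + 1) ∉ B := by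
  refine ⟨fun h => ⟨fun i h1 h2 => h i h1 (by omega), h _ (by omega) le_rfl⟩,
    fun h i h1 h2 => ?_⟩
  rcases Nat.le_succ_iff.1 h2 with h3 | rfl
  · exact h.1 i h1 h3
  · exact h.2

/-- The visit `hy` is needed: without one, `hitIndex` takes its default value `0`. -/
theorem lt_hitIndex_iff {X : Type*} {B : Set X} {y : ℕ → X} (hy : ∃ n, 1 ≤ n ∧ y n ∈ B) {n : ℕ} :
    n < hitIndex B y ↔ y ∈ avoidUpTo B n := by
  constructor
  · intro h i h1 h2 hi
    exact Nat.notMem_of_lt_sInf (h2.trans_lt h) ⟨h1, hi⟩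
  · intro h
    by_contra! hle
    have hmem := Nat.sInf_mem (s := {n | 1 ≤ n ∧ y n ∈ B}) hy
    exact h _ hmem.1 hle hmem.2

theorem stoppedPath_mem_pathsBetween {X : Type*} {A B : Set X} {y : ℕ → X} (h0 : y 0 ∈ A)
    (hy : ∃ n, 1 ≤ n ∧ y n ∈ B) : stoppedPath B y ∈ pathsBetween A B := by
  refine ⟨h0, (Nat.sInf_mem (s := {n | 1 ≤ n ∧ y n ∈ B}) hy).2, fun i hi0 hil hiB => ?_⟩
  have hlt : (i : ℕ) < hitIndex B y := Fin.val_lt_last hil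
  exact (lt_hitIndex_iff hy).1 hlt i (Nat.one_le_iff_ne_zero.2 fun h => hi0 (Fin.ext h)) le_rfl hiB

/-- Replaces a sum up to a random time by a series over fixed times, to which the Markov property
applies term by term. -/
theorem sum_edge_stoppedPath {X : Type*} {B : Set X} {y : ℕ → X} (hy : ∃ n, 1 ≤ n ∧ y n ∈ B)
    (f : X × X → ℝ≥0∞) :
    ∑ j : Fin (stoppedPath B y).1, f (edge (stoppedPath B y) j) =
      ∑' n, (avoidUpTo B n).indicator (fun y => f (y n, y (n + 1))) y := by
  rw [tsum_eq_sum (s := Finset.range (hitIndex B y))]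
  · rw [Finset.sum_range]
    refine Finset.sum_congr rfl fun j _ => ?_
    rw [indicator_of_mem ((lt_hitIndex_iff hy).1 j.2)]
    rfl
  · intro n hn
    exact indicator_of_notMem (fun h => hn (Finset.mem_range.2 ((lt_hitIndex_iff hy).2 h))) _

variable {Φ : Measure (Ω × Ω)} {A B : Set Ω} {ℓ : Kernel Ω Ω}

/-- One step of the chain with kernel `ℓ`, killed in `B`. -/
noncomputable def killedStep (B : Set Ω) (ℓ : Kernel Ω Ω) (m : Measure Ω) : Measure Ω :=
  (m.bind ℓ).restrict Bᶜ

theorem killedStep_apply (hB : MeasurableSet B) (m : Measure Ω) {s : Set Ω}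
    (hs : MeasurableSet s) : killedStep B ℓ m s = ∫⁻ x, ℓ x (s ∩ Bᶜ) ∂m := by
  rw [killedStep, Measure.restrict_apply hs,
    Measure.bind_apply (hs.inter hB.compl) ℓ.measurable.aemeasurable]

theorem killedStep_sum (hB : MeasurableSet B) {ι : Type*} (m : ι → Measure Ω) :
    killedStep B ℓ (Measure.sum m) = Measure.sum fun i => killedStep B ℓ (m i) := by
  refine Measure.ext fun s hs => ?_
  rw [killedStep_apply hB _ hs, lintegral_sum_measure, Measure.sum_apply _ hs]
  exact tsum_congr fun i => (killedStep_apply hB _ hs).symm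

theorem killedStep_add (hB : MeasurableSet B) (m₁ m₂ : Measure Ω) :
    killedStep B ℓ (m₁ + m₂) = killedStep B ℓ m₁ + killedStep B ℓ m₂ := by
  refine Measure.ext fun s hs => ?_
  rw [killedStep_apply hB _ hs, lintegral_add_measure, Measure.add_apply,
    killedStep_apply hB _ hs, killedStep_apply hB _ hs]

theorem killedStep_mono (hB : MeasurableSet B) {m₁ m₂ : Measure Ω} (h : m₁ ≤ m₂) :
    killedStep B ℓ m₁ ≤ killedStep B ℓ m₂ := by
  refine Measure.le_iff.2 fun s hs => ?_
  rw [killedStep_apply hB _ hs, killedStep_apply hB _ hs]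
  exact lintegral_mono' h le_rfl

variable [IsMarkovKernel ℓ]

variable (Φ A B ℓ) in
/-- The law of the state at time `n` of the chain of the flow `Φ`, on the event that the chain has
not yet reached `B`. -/
noncomputable def occupation (n : ℕ) : Measure Ω :=
  ((flowChainLaw Φ A ℓ).restrict (avoidUpTo B n)).map fun y => y n

theorem lintegral_flowChainLaw {f : (ℕ → Ω) → ℝ≥0∞} (hf : Measurable f) :
    ∫⁻ y, f y ∂(flowChainLaw Φ A ℓ) = ∫⁻ x in A, ∫⁻ y, f y ∂(chainLaw ℓ x) ∂Φ.fst :=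
  Measure.lintegral_bind (chainLaw ℓ).measurable.aemeasurable hf.aemeasurable

theorem map_eval_zero_flowChainLaw : (flowChainLaw Φ A ℓ).map (fun y => y 0) = Φ.fst.restrict A := by
  refine Measure.ext_of_lintegral _ fun f hf => ?_
  rw [lintegral_map hf (measurable_pi_apply 0), lintegral_flowChainLaw (by fun_prop)]
  refine lintegral_congr fun x => ?_
  rw [← lintegral_map hf (measurable_pi_apply 0), map_eval_zero_chainLaw, lintegral_dirac' _ hf]

theorem lintegral_occupation (hB : MeasurableSet B) (n : ℕ) {f : Ω → ℝ≥0∞} (hf : Measurable f) :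
    ∫⁻ x, f x ∂(occupation Φ A B ℓ n) =
      ∫⁻ y, (avoidUpTo B n).indicator (fun y => f (y n)) y ∂(flowChainLaw Φ A ℓ) := by
  rw [occupation, lintegral_map hf (measurable_pi_apply n),
    lintegral_indicator (measurableSet_avoidUpTo hB n)]

theorem lintegral_avoidUpTo_edge (hB : MeasurableSet B) (n : ℕ) {g : Ω × Ω → ℝ≥0∞}
    (hg : Measurable g) :
    ∫⁻ y, (avoidUpTo B n).indicator (fun y => g (y n, y (n + 1))) y ∂(flowChainLaw Φ A ℓ) =
      ∫⁻ x, ∫⁻ z, g (x, z) ∂(ℓ x) ∂(occupation Φ A B ℓ n) := by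
  have hS := measurableSet_avoidUpTo hB n
  have hgm : Measurable fun x => ∫⁻ z, g (x, z) ∂(ℓ x) := hg.lintegral_kernel_prod_right'
  rw [lintegral_occupation hB n hgm, lintegral_flowChainLaw, lintegral_flowChainLaw]
  rotate_left
  · exact (hgm.comp (measurable_pi_apply n)).indicator hS
  · exact Measurable.indicator (by fun_prop) hS
  refine lintegral_congr fun x => ?_
  set T : Set ((i : Finset.Iic n) → Ω) :=
    ⋂ i : Finset.Iic n, {z | 1 ≤ (i : ℕ) → z i ∉ B} with hT
  have hTm : MeasurableSet T := by
    refine MeasurableSet.iInter fun i => ?_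
    by_cases hi : 1 ≤ (i : ℕ)
    · simp only [hi, forall_const]
      exact measurable_pi_apply (X := fun _ : Finset.Iic n => Ω) i hB.compl
    · simp [hi]
  have key := lintegral_chainLaw_succ ℓ x n (F := T.indicator 1) (measurable_one.indicator hTm) hg
  have hmem : ∀ y : ℕ → Ω, Preorder.frestrictLe (π := fun _ => Ω) n y ∈ T ↔ y ∈ avoidUpTo B n := by
    intro y
    simp only [hT, mem_iInter, avoidUpTo, mem_ofPred_eq, Preorder.frestrictLe_apply]
    exact ⟨fun h i h1 h2 => h ⟨i, Finset.mem_Iic.2 h2⟩ h1,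
      fun h i h1 => h i h1 (Finset.mem_Iic.1 i.2)⟩
  have hind : ∀ (y : ℕ → Ω) (f : (ℕ → Ω) → ℝ≥0∞), (avoidUpTo B n).indicator f y =
      T.indicator 1 (Preorder.frestrictLe (π := fun _ => Ω) n y) * f y := fun y f => by
    by_cases hy : y ∈ avoidUpTo B n
    · simp [hy, (hmem y).2 hy]
    · simp [hy, mt (hmem y).1 hy]
  simp_rw [hind]
  exact key

theorem occupation_zero : occupation Φ A B ℓ 0 = Φ.fst.restrict A := by
  rw [occupation, avoidUpTo_zero, Measure.restrict_univ, map_eval_zero_flowChainLaw]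

theorem occupation_succ (hB : MeasurableSet B) (n : ℕ) :
    occupation Φ A B ℓ (n + 1) = killedStep B ℓ (occupation Φ A B ℓ n) := by
  refine Measure.ext fun s hs => ?_
  have hs' := hs.inter hB.compl
  rw [killedStep_apply hB _ hs, ← lintegral_indicator_one hs,
    lintegral_occupation hB _ (measurable_one.indicator hs)]
  have := lintegral_avoidUpTo_edge (Φ := Φ) (A := A) (ℓ := ℓ) hB n
    (g := fun z => (s ∩ Bᶜ).indicator 1 z.2) ((measurable_one.indicator hs').comp measurable_snd)
  simp only [lintegral_indicator_one hs'] at this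
  rw [← this]
  refine lintegral_congr fun y => ?_
  by_cases h1 : y ∈ avoidUpTo B n <;> by_cases h2 : y (n + 1) ∈ B <;>
    by_cases h3 : y (n + 1) ∈ s <;> simp [indicator, mem_avoidUpTo_succ, h1, h2, h3]

theorem sum_occupation_eq (hB : MeasurableSet B) :
    Measure.sum (occupation Φ A B ℓ) =
      Φ.fst.restrict A + killedStep B ℓ (Measure.sum (occupation Φ A B ℓ)) := by
  rw [killedStep_sum hB]
  refine Measure.ext fun s hs => ?_
  rw [Measure.sum_apply _ hs, Measure.add_apply, Measure.sum_apply _ hs,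
    tsum_eq_zero_add' ENNReal.summable, occupation_zero]
  simp only [occupation_succ hB]

/-- A measure is zero if it is invariant under the killed step and the steps strictly decrease a
bounded function. -/
theorem eq_zero_of_killedStep_eq {m : Measure Ω} [IsFiniteMeasure m]
    (hm : m = killedStep B ℓ m) {H : Ω → ℝ≥0∞} (hH : Measurable H) (hH1 : ∀ x, H x ≤ 1)
    (hdec : ∀ᵐ x ∂m, ∀ᵐ y ∂(ℓ x), H y < H x) : m = 0 := by
  by_contra hne
  -- Invariance and the loss of mass in `B` give this bound, while the strict decrease of `H` gives
  -- the opposite strict inequality.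
  have h1 : ∫⁻ x, H x ∂m ≤ ∫⁻ x, ∫⁻ y, H y ∂(ℓ x) ∂m := by
    conv_lhs => rw [hm, killedStep]
    refine (setLIntegral_le_lintegral _ _).trans ?_
    rw [Measure.lintegral_bind ℓ.measurable.aemeasurable hH.aemeasurable]
  have hle : ∀ x, ∫⁻ y, H y ∂(ℓ x) ≤ 1 := fun x => (lintegral_mono hH1).trans (by simp)
  have h2 : ∀ᵐ x ∂m, ∫⁻ y, H y ∂(ℓ x) < H x := by
    filter_upwards [hdec] with x hx
    have := lintegral_strict_mono (μ := ℓ x) (f := H) (g := fun _ => H x)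
      (IsProbabilityMeasure.ne_zero _) (by fun_prop) (lintegral_lt_top_of_le_one hH1).ne hx
    simpa using this
  exact absurd (lintegral_strict_mono hne hH.aemeasurable (lintegral_lt_top_of_le_one hle).ne h2)
    h1.not_gt

/-- A flow without source outside `A` and sink outside `B`, all of whose edges strictly decrease a
bounded function, is the flow of the chain started in `A` and killed in `B`. -/
theorem sum_occupation_eq_fst [IsFiniteMeasure Φ] (hB : MeasurableSet B)
    (hΦ : Φ = Φ.fst ⊗ₘ ℓ) (hbal : Φ.fst = Φ.fst.restrict A + Φ.snd.restrict Bᶜ)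
    {H : Ω → ℝ≥0∞} (hH : Measurable H) (hH1 : ∀ x, H x ≤ 1) (hdec : ∀ᵐ z ∂Φ, H z.2 < H z.1) :
    Measure.sum (occupation Φ A B ℓ) = Φ.fst := by
  have hsnd : Φ.snd = Φ.fst.bind ℓ := by
    conv_lhs => rw [hΦ]
    exact Measure.snd_compProd _ _
  have hinv : Φ.fst = Φ.fst.restrict A + killedStep B ℓ Φ.fst := by
    conv_lhs => rw [hbal]
    rw [killedStep, hsnd]
  -- The occupation measures build the smallest solution of the equation `hinv`, so they stay below
  -- `Φ.fst`.
  have hpart : ∀ N, ∑ n ∈ Finset.range N, occupation Φ A B ℓ n ≤ Φ.fst := by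
    intro N
    induction N with
    | zero => simpa using Measure.zero_le _
    | succ N ih =>
      have hstep : ∑ n ∈ Finset.range N, occupation Φ A B ℓ (n + 1) =
          killedStep B ℓ (∑ n ∈ Finset.range N, occupation Φ A B ℓ n) := by
        clear ih
        induction N with
        | zero =>
          refine Measure.ext fun s hs => ?_
          rw [killedStep_apply hB _ hs]
          simp
        | succ N ih =>
          rw [Finset.sum_range_succ, Finset.sum_range_succ, killedStep_add hB, ih, occupation_succ hB]
      rw [Finset.sum_range_succ', hstep, occupation_zero, add_comm]
      exact (add_le_add le_rfl (killedStep_mono hB ih)).trans hinv.ge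
  set G := Measure.sum (occupation Φ A B ℓ) with hG
  have hGle : G ≤ Φ.fst := by
    refine Measure.le_iff.2 fun s hs => ?_
    rw [hG, Measure.sum_apply _ hs, ENNReal.tsum_eq_iSup_nat]
    refine iSup_le fun N => ?_
    have := hpart N s
    rwa [Measure.finsetSum_apply] at this
  have hGfin : IsFiniteMeasure G := isFiniteMeasure_of_le _ hGle
  have hsub : Φ.fst - G + G = Φ.fst := Measure.sub_add_cancel_of_le hGle
  -- The remainder would be the part of the flow never reached from `A`. The source term cancels,
  -- leaving it invariant under the killed step.
  have hsubinv : Φ.fst - G = killedStep B ℓ (Φ.fst - G) := by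
    have h1 : Φ.fst - G + G = killedStep B ℓ (Φ.fst - G) + G := by
      rw [hsub]
      nth_rw 2 [hG]
      rw [sum_occupation_eq hB, ← hG, add_left_comm, ← killedStep_add hB, hsub]
      exact hinv
    refine Measure.ext fun s _ => ?_
    have h2 := congrArg (fun m : Measure Ω => m s) h1
    simp only [Measure.add_apply] at h2
    exact (ENNReal.add_left_inj (measure_ne_top G s)).1 h2
  have hdec' : ∀ᵐ x ∂Φ.fst, ∀ᵐ y ∂(ℓ x), H y < H x := by
    rw [hΦ] at hdec
    exact Measure.ae_ae_of_ae_compProd hdec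
  have h0 := eq_zero_of_killedStep_eq hsubinv hH hH1
    ((Measure.absolutelyContinuous_of_le Measure.sub_le).ae_le hdec')
  rw [h0, zero_add] at hsub
  exact hsub

/-- The chain of such a flow reaches `B`. -/
theorem ae_exists_mem_of_sum_occupation [IsFiniteMeasure Φ]
    (h : Measure.sum (occupation Φ A B ℓ) = Φ.fst) :
    ∀ᵐ y ∂(flowChainLaw Φ A ℓ), ∃ n, 1 ≤ n ∧ y n ∈ B := by
  have hocc : ∀ n, occupation Φ A B ℓ n univ = flowChainLaw Φ A ℓ (avoidUpTo B n) := fun n => by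
    rw [occupation, Measure.map_apply (measurable_pi_apply n) MeasurableSet.univ, preimage_univ,
      Measure.restrict_apply_univ]
  -- The series is the mean time to reach `B`, equal to the finite total mass of `Φ.fst`.
  have hfin : ∑' n, flowChainLaw Φ A ℓ (avoidUpTo B n) ≠ ∞ := by
    simp_rw [← hocc]
    rw [← Measure.sum_apply _ MeasurableSet.univ, h]
    exact measure_ne_top _ _
  have hlim := ENNReal.tendsto_atTop_zero_of_tsum_ne_top hfin
  rw [ae_iff]
  refine le_antisymm (ge_of_tendsto' hlim fun n => measure_mono fun y hy i h1 _ hi => ?_) zero_le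
  exact hy ⟨i, h1, hi⟩

theorem edgeMeasure_flowPathLaw [IsFiniteMeasure Φ] (hB : MeasurableSet B)
    (h : Measure.sum (occupation Φ A B ℓ) = Φ.fst) (hΦ : Φ = Φ.fst ⊗ₘ ℓ) :
    edgeMeasure (flowPathLaw Φ A B ℓ) = Φ := by
  refine Measure.ext_of_lintegral _ fun f hf => ?_
  rw [lintegral_edgeMeasure _ hf, flowPathLaw,
    lintegral_map (measurable_sum_edge hf) (measurable_stoppedPath hB)]
  have h1 : ∀ᵐ y ∂(flowChainLaw Φ A ℓ), ∑ j : Fin (stoppedPath B y).1, f (edge (stoppedPath B y) j) =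
      ∑' n, (avoidUpTo B n).indicator (fun y => f (y n, y (n + 1))) y := by
    filter_upwards [ae_exists_mem_of_sum_occupation h] with y hy
    exact sum_edge_stoppedPath hy f
  rw [lintegral_congr_ae h1, lintegral_tsum fun n =>
    (Measurable.indicator (by fun_prop) (measurableSet_avoidUpTo hB n)).aemeasurable]
  simp_rw [fun n => lintegral_avoidUpTo_edge (Φ := Φ) (A := A) (ℓ := ℓ) hB n hf]
  rw [← lintegral_sum_measure, h]
  conv_rhs => rw [hΦ]
  rw [Measure.lintegral_compProd hf]

theorem ae_flowPathLaw_mem_pathsBetween [IsFiniteMeasure Φ] (hA : MeasurableSet A)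
    (hB : MeasurableSet B) (h : Measure.sum (occupation Φ A B ℓ) = Φ.fst) :
    ∀ᵐ γ ∂(flowPathLaw Φ A B ℓ), γ ∈ pathsBetween A B := by
  refine (ae_map_iff (measurable_stoppedPath hB).aemeasurable
    (measurableSet_pathsBetween hA hB)).2 ?_
  have h0 : ∀ᵐ y ∂(flowChainLaw Φ A ℓ), y 0 ∈ A := by
    refine ae_of_ae_map (f := fun y : ℕ → Ω => y 0) (p := fun x => x ∈ A)
      (measurable_pi_apply 0).aemeasurable ?_
    rw [map_eval_zero_flowChainLaw]
    exact ae_restrict_mem hA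
  filter_upwards [h0, ae_exists_mem_of_sum_occupation h] with y hy0 hy
  exact stoppedPath_mem_pathsBetween hy0 hy

theorem isProbabilityMeasure_flowPathLaw (hB : MeasurableSet B) (h1 : Φ.fst A = 1) :
    IsProbabilityMeasure (flowPathLaw Φ A B ℓ) := by
  have : IsProbabilityMeasure (flowChainLaw Φ A ℓ) := by
    constructor
    rw [← lintegral_one, lintegral_flowChainLaw measurable_const]
    simp [h1]
  exact Measure.isProbabilityMeasure_map (measurable_stoppedPath hB).aemeasurable

end FlowChain
-- The unit flow of a potential and its path measure.
section PotentialFlow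

/-- The unit flow of a potential `H`. -/
noncomputable def potentialFlow (K : Measure (Ω × Ω)) (A : Set Ω) (H : Ω → ℝ≥0∞) :
    Measure (Ω × Ω) :=
  (outFlow K A H)⁻¹ • K.withDensity fun z => H z.1 - H z.2

namespace IsPotential

variable {K : Measure (Ω × Ω)} {A B : Set Ω} {H : Ω → ℝ≥0∞}

theorem lintegral_potentialFlow (h : IsPotential K A B H) {g : Ω × Ω → ℝ≥0∞} (hg : Measurable g) :
    ∫⁻ z, g z ∂(potentialFlow K A H) =
      (outFlow K A H)⁻¹ * ∫⁻ z, g z * (H z.1 - H z.2) ∂K := by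
  have hm := h.measurable
  rw [potentialFlow, lintegral_smul_measure,
    lintegral_withDensity_eq_lintegral_mul _ (by fun_prop) hg, smul_eq_mul]
  simp only [Pi.mul_apply, mul_comm]

theorem potentialFlow_fst_apply (h : IsPotential K A B H) {s : Set Ω} (hs : MeasurableSet s) :
    (potentialFlow K A H).fst s =
      (outFlow K A H)⁻¹ * ∫⁻ z, s.indicator 1 z.1 * (H z.1 - H z.2) ∂K := by
  have hs1 : Measurable (s.indicator (1 : Ω → ℝ≥0∞)) := measurable_one.indicator hs
  rw [← lintegral_indicator_one hs, Measure.fst, lintegral_map hs1 measurable_fst,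
    h.lintegral_potentialFlow (g := fun z => s.indicator 1 z.1) (hs1.comp measurable_fst)]

theorem potentialFlow_snd_apply (h : IsPotential K A B H) {s : Set Ω} (hs : MeasurableSet s) :
    (potentialFlow K A H).snd s =
      (outFlow K A H)⁻¹ * ∫⁻ z, s.indicator 1 z.2 * (H z.1 - H z.2) ∂K := by
  have hs1 : Measurable (s.indicator (1 : Ω → ℝ≥0∞)) := measurable_one.indicator hs
  rw [← lintegral_indicator_one hs, Measure.snd, lintegral_map hs1 measurable_snd,
    h.lintegral_potentialFlow (g := fun z => s.indicator 1 z.2) (hs1.comp measurable_snd)]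

theorem ae_potentialFlow_lt (h : IsPotential K A B H) :
    ∀ᵐ z ∂(potentialFlow K A H), H z.2 < H z.1 := by
  have hm := h.measurable
  refine Measure.ae_smul_measure ?_ _
  rw [ae_withDensity_iff (by fun_prop)]
  exact Filter.Eventually.of_forall fun z hz => tsub_pos_iff_lt.1 (pos_iff_ne_zero.2 hz)

theorem potentialFlow_absolutelyContinuous : potentialFlow K A H ≪ K :=
  Measure.AbsolutelyContinuous.smul_left (withDensity_absolutelyContinuous _ _) _

variable [IsFiniteMeasure K]

theorem isFiniteMeasure_potentialFlow (h : IsPotential K A B H) (h0 : outFlow K A H ≠ 0) :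
    IsFiniteMeasure (potentialFlow K A H) := by
  constructor
  rw [← lintegral_one, h.lintegral_potentialFlow measurable_const]
  refine ENNReal.mul_lt_top (ENNReal.inv_lt_top.2 (pos_iff_ne_zero.2 h0))
    (lintegral_lt_top_of_le_one fun z => ?_)
  rw [one_mul]
  exact tsub_le_self.trans (h.le_one _)

theorem potentialFlow_fst_eq_one (h : IsPotential K A B H) (hA : MeasurableSet A)
    (h0 : outFlow K A H ≠ 0) : (potentialFlow K A H).fst A = 1 := by
  rw [h.potentialFlow_fst_apply hA, h.lintegral_indicator_flow,
    ENNReal.inv_mul_cancel h0 (outFlow_lt_top K A H).ne]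

theorem potentialFlow_fst (h : IsPotential K A B H) (hA : MeasurableSet A) (hB : MeasurableSet B) :
    (potentialFlow K A H).fst =
      (potentialFlow K A H).fst.restrict A + (potentialFlow K A H).snd.restrict Bᶜ := by
  refine Measure.ext fun s hs => ?_
  rw [Measure.add_apply, Measure.restrict_apply hs, Measure.restrict_apply hs,
    h.potentialFlow_fst_apply hs, h.potentialFlow_fst_apply (hs.inter hA),
    h.potentialFlow_snd_apply (hs.inter hB.compl),
    h.lintegral_flow_balance hA hB (measurable_one.indicator hs) (indicator_one_le_one s), mul_add]
  simp only [indicator_indicator, inter_comm]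

theorem rnDeriv_potentialFlow (h : IsPotential K A B H) (h0 : outFlow K A H ≠ 0) :
    (potentialFlow K A H).rnDeriv K =ᵐ[K] fun z => (outFlow K A H)⁻¹ * (H z.1 - H z.2) := by
  have hm := h.measurable
  rw [potentialFlow, ← withDensity_smul' _ _ (ENNReal.inv_ne_top.2 h0)]
  exact Measure.rnDeriv_withDensity K (by fun_prop)

/-- A path measure from `A` to `B` whose edge measure is the flow of the potential is concentrated
on self-avoiding paths, and its value is the flow out of `A`. -/
theorem pathValue_eq_outFlow (h : IsPotential K A B H) (h0 : outFlow K A H ≠ 0)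
    {P : Measure (FinPath Ω)} (hP : P ∈ admissible K A B)
    (hedge : edgeMeasure P = potentialFlow K A H) :
    (∀ᵐ γ ∂P, γ ∈ selfAvoiding) ∧ pathValue K P = outFlow K A H := by
  obtain ⟨hprob, hpath, -⟩ := hP
  have hlt : ∀ᵐ γ ∂P, ∀ j, H (edge γ j).2 < H (edge γ j).1 :=
    ae_forall_edge (by rw [hedge]; exact h.ae_potentialFlow_lt)
  have hder : ∀ᵐ γ ∂P, ∀ j, (edgeMeasure P).rnDeriv K (edge γ j) =
      (outFlow K A H)⁻¹ * (H (edge γ j).1 - H (edge γ j).2) := by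
    refine ae_forall_edge (q := fun z => (edgeMeasure P).rnDeriv K z =
      (outFlow K A H)⁻¹ * (H z.1 - H z.2)) ?_
    rw [hedge]
    exact potentialFlow_absolutelyContinuous.ae_le (h.rnDeriv_potentialFlow h0)
  refine ⟨hlt.mono fun γ hγ => injective_of_strictAnti_edges hγ, ?_⟩
  have hval : ∀ᵐ γ ∂P,
      (∑ j : Fin γ.1, (edgeMeasure P).rnDeriv K (edge γ j))⁻¹ = outFlow K A H := by
    -- The drops of `H` along a decreasing path from `A` to `B` sum to `1`, so the sum of densities
    -- is the same for almost every path.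
    filter_upwards [hlt, hder, hpath] with γ h1 h2 h3
    simp_rw [h2]
    rw [← Finset.mul_sum, tsub_sum_eq_one (h.eq_one _ h3.1) (h.eq_zero _ h3.2.1)
      fun j => (h1 j).le, mul_one, inv_inv]
  rw [pathValue, lintegral_congr_ae hval]
  simp

/-- The chain of the flow of a potential. -/
theorem flowPathLaw_potentialFlow (h : IsPotential K A B H) (hA : MeasurableSet A)
    (hB : MeasurableSet B) (h0 : outFlow K A H ≠ 0) (ℓ : Kernel Ω Ω) [IsMarkovKernel ℓ]
    (hℓ : Disintegrates (potentialFlow K A H) ℓ) :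
    (∀ᵐ y ∂(flowChainLaw (potentialFlow K A H) A ℓ), ∃ n, 1 ≤ n ∧ y n ∈ B) ∧
      flowPathLaw (potentialFlow K A H) A B ℓ ∈ admissible K A B ∧
      edgeMeasure (flowPathLaw (potentialFlow K A H) A B ℓ) = potentialFlow K A H := by
  have hfin := h.isFiniteMeasure_potentialFlow h0
  have hocc := sum_occupation_eq_fst hB hℓ.2 (h.potentialFlow_fst hA hB) h.measurable h.le_one
    h.ae_potentialFlow_lt
  have hedge := edgeMeasure_flowPathLaw hB hocc hℓ.2
  refine ⟨ae_exists_mem_of_sum_occupation hocc, ⟨isProbabilityMeasure_flowPathLaw hB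
    (h.potentialFlow_fst_eq_one hA h0), ae_flowPathLaw_mem_pathsBetween hA hB hocc, ?_⟩, hedge⟩
  rw [hedge]
  exact potentialFlow_absolutelyContinuous

end IsPotential

end PotentialFlow

/-! ### Identification of the harmonic flow and positivity of the capacity. -/

section Conductance

variable {k : Kernel Ω Ω} [hk : FiniteRates k] {μ : Measure Ω} [SFinite μ] {A B : Set Ω}

theorem harmonicFlow_eq [MeasurableSingletonClass Ω]
    (hrev : (conductance μ k).map Prod.swap = conductance μ k)
    (hpos : ∀ᵐ x ∂μ, 0 < k x univ)
    (hA : MeasurableSet A) (hB : MeasurableSet B) (hAB : Disjoint A B)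
    (hcap : ENNReal.ofReal (capacity μ k A B) =
      outFlow (conductance μ k) A (chainHarmonic k A B)) :
    harmonicFlow μ k A B = potentialFlow (conductance μ k) A (chainHarmonic k A B) := by
  have h := harmonic_ae_eq hrev hpos hA hB hAB
  have h1 : ∀ᵐ z ∂(conductance μ k), harmonic k A B z.1 = (chainHarmonic k A B z.1).toReal := by
    have := conductance_prod_univ_eq_zero k h
    rwa [prod_univ] at this
  have h2 : ∀ᵐ z ∂(conductance μ k), harmonic k A B z.2 = (chainHarmonic k A B z.2).toReal := by
    have := conductance_univ_prod_eq_zero hrev h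
    rwa [univ_prod] at this
  have htop : ∀ x, chainHarmonic k A B x ≠ ∞ := fun x =>
    ((chainHarmonic_le_one k hA hB x).trans_lt ENNReal.one_lt_top).ne
  rw [harmonicFlow, potentialFlow, hcap]
  congr 1
  refine withDensity_congr_ae ?_
  filter_upwards [h1, h2] with z hz1 hz2
  rw [hz1, hz2, ENNReal.ofReal_sub _ ENNReal.toReal_nonneg, ENNReal.ofReal_toReal (htop _),
    ENNReal.ofReal_toReal (htop _)]

/-- With zero flow, `H` is constant along almost every edge. Then the chain cannot leave `{H = 0}`,
which contains `B` and misses `A`; by irreducibility that set is `μ`-null, contradicting `μ B ≠ 0`.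
-/
theorem outFlow_ne_zero [IsFiniteMeasure (conductance μ k)]
    (hrev : (conductance μ k).map Prod.swap = conductance μ k)
    (hpos : ∀ᵐ x ∂μ, 0 < k x univ) (hirr : IsIrreducible k μ)
    (hA : MeasurableSet A) (hB : MeasurableSet B) (hAB : Disjoint A B)
    (hμA : μ A ≠ 0) (hμB : μ B ≠ 0) :
    outFlow (conductance μ k) A (chainHarmonic k A B) ≠ 0 := by
  intro h0
  have hpot := isPotential_chainHarmonic hrev hA hB hAB
  have hK := Measure.ae_ae_of_ae_compProd (hpot.ae_eq_of_outFlow_eq_zero hA hB h0)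
  have hS : ∀ᵐ x ∂μ, x ∈ {x | chainHarmonic k A B x = 0} →
      jumpKernel k x {x | chainHarmonic k A B x = 0}ᶜ = 0 := by
    filter_upwards [hK, hpos] with x hx hx0 hxS
    have h1 : ∀ᵐ y ∂(k x), y ∈ {x | chainHarmonic k A B x = 0} :=
      hx.mono fun y hy => hy.symm.trans hxS
    have h2 : k x {x | chainHarmonic k A B x = 0}ᶜ = 0 := h1
    rw [← rate_smul_jumpKernel k x, Measure.smul_apply, smul_eq_mul, mul_eq_zero] at h2
    exact h2.resolve_left hx0.ne'
  have hhit := hitProb_univ_eq_zero (jumpKernel k) (A := A)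
    (fun N hN => (ae_jumpKernel_eq_zero hrev hpos hN).2) hS fun x hx hxA => by
      rw [mem_ofPred_eq, hpot.eq_one x hxA] at hx
      exact one_ne_zero hx
  refine hμB (measure_mono_null (t := {x | chainHarmonic k A B x = 0}) hpot.eq_zero ?_)
  have : ∀ᵐ x ∂μ, x ∉ {x | chainHarmonic k A B x = 0} := by
    filter_upwards [hhit, ae_hitProb_ne_zero hirr hA hμA] with x h1 h2 h3 using h2 (h1 h3)
  simpa [ae_iff] using this

end Conductance

end BermanKonsowa

/-! ### The Berman–Konsowa principle. -/

open BermanKonsowa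
theorem theorem1 {Ω : Type*} [TopologicalSpace Ω] [PolishSpace Ω] [MeasurableSpace Ω]
    [BorelSpace Ω] (k : Kernel Ω Ω) [FiniteRates k] (μ : Measure Ω) [SigmaFinite μ]
    (hrev : (conductance μ k).map Prod.swap = conductance μ k)
    (hfin : conductance μ k univ < ∞)
    (hpos : ∀ᵐ x ∂μ, 0 < k x univ)
    (hirr : IsIrreducible k μ)
    (A B : Set Ω) (hA : MeasurableSet A) (hB : MeasurableSet B) (hAB : Disjoint A B) :
    0 ≤ capacity μ k A B ∧
    -- the variational formula
    ENNReal.ofReal (capacity μ k A B) =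
      ⨆ P ∈ admissible (conductance μ k) A B, pathValue (conductance μ k) P ∧
    -- the same formula with self-avoiding paths only
    ENNReal.ofReal (capacity μ k A B) =
      ⨆ P ∈ {P ∈ admissible (conductance μ k) A B | ∀ᵐ γ ∂P, γ ∈ selfAvoiding},
        pathValue (conductance μ k) P ∧
    -- the path measure of the harmonic flow is a maximizer in both formulas
    (μ A ≠ 0 → μ B ≠ 0 →
      0 < capacity μ k A B ∧
      (∃ ℓ : Kernel Ω Ω, Disintegrates (harmonicFlow μ k A B) ℓ) ∧
      ∀ (ℓ : Kernel Ω Ω) [IsMarkovKernel ℓ], Disintegrates (harmonicFlow μ k A B) ℓ →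
        (∀ᵐ y ∂(flowChainLaw (harmonicFlow μ k A B) A ℓ), ∃ n, 1 ≤ n ∧ y n ∈ B) ∧
        flowPathLaw (harmonicFlow μ k A B) A B ℓ ∈ admissible (conductance μ k) A B ∧
        (∀ᵐ γ ∂(flowPathLaw (harmonicFlow μ k A B) A B ℓ), γ ∈ selfAvoiding) ∧
        edgeMeasure (flowPathLaw (harmonicFlow μ k A B) A B ℓ) = harmonicFlow μ k A B ∧
        pathValue (conductance μ k) (flowPathLaw (harmonicFlow μ k A B) A B ℓ) =
          ENNReal.ofReal (capacity μ k A B)) := by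
  have hKfin : IsFiniteMeasure (conductance μ k) := ⟨hfin⟩
  set K := conductance μ k with hK
  set H := chainHarmonic k A B with hH
  have hpot : IsPotential K A B H := isPotential_chainHarmonic hrev hA hB hAB
  have hcap : capacity μ k A B = (outFlow K A H).toReal := by
    rw [capacity_eq_toReal hrev hpos hA hB hAB, outFlow,
      ← lintegral_indicator (hA.prod MeasurableSet.univ)]
    congr 1
    refine lintegral_congr fun z => ?_
    by_cases hz : z.1 ∈ A <;> simp [hz, indicator, hH]
  have hcap' : ENNReal.ofReal (capacity μ k A B) = outFlow K A H := by
    rw [hcap, ENNReal.ofReal_toReal (outFlow_lt_top K A H).ne]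
  have hle : ∀ P ∈ admissible K A B, pathValue K P ≤ outFlow K A H := fun P hP =>
    (pathValue_le hpot.measurable hpot.eq_one hpot.eq_zero hP).trans_eq (hpot.lintegral_sq hA hB)
  rw [hcap']
  refine ⟨hcap ▸ ENNReal.toReal_nonneg, ?_⟩
  by_cases hAB0 : μ A ≠ 0 ∧ μ B ≠ 0
  · have h0 : outFlow K A H ≠ 0 := outFlow_ne_zero hrev hpos hirr hA hB hAB hAB0.1 hAB0.2
    rw [harmonicFlow_eq hrev hpos hA hB hAB hcap', ← hK, ← hH]
    have hΦ := hpot.isFiniteMeasure_potentialFlow h0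
    have hne : Nonempty Ω := (nonempty_of_measure_ne_zero hAB0.1).to_type
    have hdis : Disintegrates (potentialFlow K A H) (potentialFlow K A H).condKernel :=
      ⟨inferInstance, (Measure.disintegrate _ _).symm⟩
    have hall : ∀ (ℓ : Kernel Ω Ω) [IsMarkovKernel ℓ], Disintegrates (potentialFlow K A H) ℓ →
        (∀ᵐ y ∂(flowChainLaw (potentialFlow K A H) A ℓ), ∃ n, 1 ≤ n ∧ y n ∈ B) ∧
        flowPathLaw (potentialFlow K A H) A B ℓ ∈ admissible K A B ∧
        (∀ᵐ γ ∂(flowPathLaw (potentialFlow K A H) A B ℓ), γ ∈ selfAvoiding) ∧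
        edgeMeasure (flowPathLaw (potentialFlow K A H) A B ℓ) = potentialFlow K A H ∧
        pathValue K (flowPathLaw (potentialFlow K A H) A B ℓ) = outFlow K A H := by
      intro ℓ _ hℓ
      obtain ⟨h1, h2, h3⟩ := hpot.flowPathLaw_potentialFlow hA hB h0 ℓ hℓ
      obtain ⟨h4, h5⟩ := hpot.pathValue_eq_outFlow h0 h2 h3
      exact ⟨h1, h2, h4, h3, h5⟩
    obtain ⟨-, h2, h4, -, h5⟩ := hall _ hdis
    refine ⟨le_antisymm (h5 ▸ le_iSup₂ (f := fun P _ => pathValue K P) _ h2) (iSup₂_le hle),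
      le_antisymm (h5 ▸ le_iSup₂ (f := fun P _ => pathValue K P) _ ⟨h2, h4⟩)
        (iSup₂_le fun P hP => hle P hP.1), fun _ _ => ⟨?_, ⟨_, hdis⟩, hall⟩⟩
    rw [hcap]
    exact ENNReal.toReal_pos h0 (outFlow_lt_top K A H).ne
  -- Degenerate case: no path measure is admissible, so both suprema are `0`, and the flow vanishes
  -- too. When `μ B = 0` this is seen from the flow into `B`.
  · have hnull : μ A = 0 ∨ μ B = 0 := by tauto
    have hKnull : K (A ×ˢ univ) = 0 ∨ K (univ ×ˢ B) = 0 :=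
      hnull.imp (conductance_prod_univ_eq_zero k) (conductance_univ_prod_eq_zero hrev)
    have h0 : outFlow K A H = 0 := by
      rcases hKnull with h | h
      · have h' : ∀ᵐ z ∂K, z.1 ∉ A := by simpa [ae_iff, prod_univ] using! h
        rw [outFlow, lintegral_congr_ae (g := 0) (h'.mono fun z hz => by simp [hz])]
        simp
      · have h' : ∀ᵐ z ∂K, z.2 ∉ B := by simpa [ae_iff, univ_prod] using! h
        rw [hpot.outFlow_eq_inFlow hA hB,
          lintegral_congr_ae (g := 0) (h'.mono fun z hz => by simp [hz])]
        simp
    rw [h0, admissible_eq_empty hAB hKnull]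
    exact ⟨by simp, by simp, fun h1 h2 => absurd ⟨h1, h2⟩ hAB0⟩
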